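/- Equip $\mathbb{R}^2$ with the Euclidean inner product and let $V=(\mathbb{R}^2)^{\otimes 3}=\mathbb{R}^2\otimes\mathbb{R}^2\otimes\mathbb{R}^2$. Two rank-one tensors $x_1\otimes x_2\otimes x_3$ and $y_1\otimes y_2\otimes y_3$ are orthogonal in at least two factors if there are indices $k_1\neq k_2$ with $x_{k_1}\perp y_{k_1}$ and $x_{k_2}\perp y_{k_2}$. A two-orthogonal decomposition of $\mathcal{T}\in V$ (of length $r$) is an expression $\mathcal{T}=\sum_{i=1}^r x^{(i)}$ with $x^{(i)}=x^{(i)}_1\otimes x^{(i)}_2\otimes x^{(i)}_3\neq 0$ for all $i$, such that $x^{(i)}$ and $x^{(j)}$ are orthogonal in at least two factors for all $i\neq j$. For $r\geq 1$ let $W_r\subseteq V$ be the Zariski closure of the set of sums $\sum_{i=1}^r x^{(i)}_1\otimes x^{(i)}_2\otimes x^{(i)}_3$ (zero summands allowed) whose summands are pairwise orthogonal in at least two factors, and let the two-orthogonal variety $W\subseteq V$ be the Zariski closure of $\bigcup_{r\geq 1}W_r$. **Theorem.** A generic tensor in $W$ has a unique two-orthogonal decomposition. That is, there is a Zariski open set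 $U\subseteq V$ such that $W\cap U$ is Zariski dense in $W$ (equivalently, $U$ meets every irreducible component of $W$) and such that every $\mathcal{T}\in W\cap U$ has a two-orthogonal decomposition, and any two two-orthogonal decompositions of $\mathcal{T}$ have the same length and the same summands $x^{(i)}\in V$ up to reordering. -/

import Mathlib

open scoped TensorProduct

noncomputable section

/-! ### The Zariski topology on a real vector space

A polynomial function on `V` is a polynomial expression in linear functionals, so a polynomial is
an element of `MvPolynomial (Module.Dual ℝ V) ℝ`, whose variable `φ` takes the value `φ v`
at `v`. -/

section Zariski

variable {V : Type*} [AddCommGroup V] [Module ℝ V]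

/-- The value at `v` of the polynomial function on `V` given by `p`. -/
def polyEval (p : MvPolynomial (Module.Dual ℝ V) ℝ) (v : V) : ℝ :=
  MvPolynomial.eval (fun φ : Module.Dual ℝ V => φ v) p

/-- `Z` is Zariski closed: it is the common zero set of a set of polynomial functions. -/
def IsZariskiClosed (Z : Set V) : Prop :=
  ∃ I : Set (MvPolynomial (Module.Dual ℝ V) ℝ), Z = {v | ∀ p ∈ I, polyEval p v = 0}

/-- `U` is Zariski open. -/
def IsZariskiOpen (U : Set V) : Prop :=
  IsZariskiClosed Uᶜ

/-- The Zariski closure of `S`: the smallest Zariski closed set that contains `S`. -/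
def zariskiClosure (S : Set V) : Set V :=
  ⋂₀ {Z : Set V | IsZariskiClosed Z ∧ S ⊆ Z}

/-- A generic point of `W` satisfies `P`: the property holds at every point of a relatively
Zariski open subset of `W` that is Zariski dense in `W` (so this subset meets every irreducible
component of `W`, when `W` is closed). -/
def HoldsGenerically (W : Set V) (P : V → Prop) : Prop :=
  ∃ U : Set V, IsZariskiOpen U ∧ W ⊆ zariskiClosure (W ∩ U) ∧ ∀ v ∈ W ∩ U, P v

end Zariski

/-! ### Two-orthogonal tensors in `⨂ k, E k` -/

section TwoOrthogonal

variable {ι : Type*} {E : ι → Type*} [∀ k, NormedAddCommGroup (E k)]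
  [∀ k, InnerProductSpace ℝ (E k)]

/-- The rank-one tensors `x₁ ⊗ ⋯ ⊗ x_d` and `y₁ ⊗ ⋯ ⊗ y_d`, given by their factors, are
orthogonal in at least two factors. -/
def AreTwoOrthogonal (x y : ∀ k, E k) : Prop :=
  ∃ k₁ k₂ : ι, k₁ ≠ k₂ ∧ inner ℝ (x k₁) (y k₁) = 0 ∧ inner ℝ (x k₂) (y k₂) = 0

/-- `x` (a family of `r` tuples of factors) is a two-orthogonal decomposition of `T` of
length `r`: the summands are nonzero, and any two of them are orthogonal in at least two factors. -/
structure IsTwoOrthogonalDecomposition (T : ⨂[ℝ] k, E k) {r : ℕ} (x : Fin r → ∀ k, E k) :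
    Prop where
  sum_eq : T = ∑ i, ⨂ₜ[ℝ] k, x i k
  ne_zero : ∀ i, (⨂ₜ[ℝ] k, x i k) ≠ 0
  orthogonal : ∀ i j, i ≠ j → AreTwoOrthogonal (x i) (x j)

/-- `T` has a two-orthogonal decomposition, and any other one has the same summands (as tensors)
up to reordering; in particular it has the same length. -/
def HasUniqueTwoOrthogonalDecomposition (T : ⨂[ℝ] k, E k) : Prop :=
  ∃ (r : ℕ) (x : Fin r → ∀ k, E k), IsTwoOrthogonalDecomposition T x ∧
    ∀ (s : ℕ) (y : Fin s → ∀ k, E k), IsTwoOrthogonalDecomposition T y →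
      ∃ σ : Fin s ≃ Fin r, ∀ j, (⨂ₜ[ℝ] k, y j k) = ⨂ₜ[ℝ] k, x (σ j) k

variable (E)

/-- `W_r`: the Zariski closure of the set of sums of `r` rank-one tensors (possibly zero), any two
of them orthogonal in at least two factors. -/
def twoOrthogonalLevel (r : ℕ) : Set (⨂[ℝ] k, E k) :=
  zariskiClosure {T | ∃ x : Fin r → ∀ k, E k,
    (∀ i j, i ≠ j → AreTwoOrthogonal (x i) (x j)) ∧ T = ∑ i, ⨂ₜ[ℝ] k, x i k}

/-- The two-orthogonal variety `W`: the Zariski closure of the union of the `W_r`, `r ≥ 1`. -/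
def twoOrthogonalVariety : Set (⨂[ℝ] k, E k) :=
  zariskiClosure (⋃ (r : ℕ) (_ : 1 ≤ r), twoOrthogonalLevel E r)

end TwoOrthogonal

end

open scoped TensorProduct

/-! ### Plane vectors -/

section Plane

/-! In the plane, two vectors orthogonal to a common nonzero vector are parallel. Hence a family of
nonzero rank-one tensors, pairwise orthogonal in two factors, is of one of two kinds
(`TwoOrthogonalFamily.classification`). Either any two members are orthogonal in exactly two factors
and parallel in the third, so that all lie in the span of four tensors of one orthogonal frame, or
there are just two members, orthogonal in two given factors, with no condition on the remaining one.

The open set consists of the tensors whose three flattenings have Gram matrices with distinct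
eigenvalues (`GramRegular`). Orthogonality in two of three factors kills the cross terms of a Gram
matrix, so the vectors in a factor are eigenvectors whenever they are pairwise orthogonal or
parallel. For a regular tensor the eigenlines are determined by the tensor. Two decompositions thus
share their lines in two common factors, and contraction recovers the third factor
(`TwoOrthogonalFamily.rankOne_mem`).

Existence must hold on all of the closure, so it needs polynomial equations. The traceless part of
each Gram matrix is a multiple of a reflection `R₁`, `R₂`, `R₃`. Sums of the first kind are
eigenvectors of `R₁ ⊗ R₂ ⊗ R₃`, those of the second kind of `R₁ ⊗ R₂ ⊗ 1` or a rotation of it. The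
defects express this by polynomials, and their product vanishes on the variety. Conversely,
expanding a regular tensor with a vanishing defect in the eigenframes leaves only terms with one
fixed product of signs, and these are pairwise orthogonal in two factors
(`hasTwoOrthogonalFamily_of_totalDefect`).

For density, each two-orthogonal sum is joined to a regular one by a line of two-orthogonal sums
(`TwoOrthogonalFamily.hasRegularLine`), and a polynomial in one variable has finitely many roots. -/

/-- The Euclidean inner product of the plane, in coordinates. -/
def dot (u v : Fin 2 → ℝ) : ℝ := u 0 * v 0 + u 1 * v 1

/-- The determinant of two plane vectors; it vanishes exactly when they are parallel. -/
def area (u v : Fin 2 → ℝ) : ℝ := u 0 * v 1 - u 1 * v 0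

/-- The rotation of the plane by a quarter turn. -/
def quarterTurn (u : Fin 2 → ℝ) : Fin 2 → ℝ := ![-u 1, u 0]

@[simp] theorem quarterTurn_zero (u : Fin 2 → ℝ) : quarterTurn u 0 = -u 1 := rfl

@[simp] theorem quarterTurn_one (u : Fin 2 → ℝ) : quarterTurn u 1 = u 0 := rfl

theorem dot_comm (u v : Fin 2 → ℝ) : dot u v = dot v u := by unfold dot; ring

theorem area_eq_zero_comm {u v : Fin 2 → ℝ} : area u v = 0 ↔ area v u = 0 := by
  unfold area; constructor <;> intro h <;> linarith

theorem area_self (u : Fin 2 → ℝ) : area u u = 0 := by unfold area; ring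

theorem dot_quarterTurn_self (u : Fin 2 → ℝ) : dot u (quarterTurn u) = 0 := by
  simp [dot]; ring

theorem dot_self_pos {u : Fin 2 → ℝ} (hu : u ≠ 0) : 0 < dot u u := by
  have : ¬ (u 0 = 0 ∧ u 1 = 0) := fun h => hu (by ext i; fin_cases i <;> simp [h.1, h.2])
  unfold dot
  by_contra h
  exact this ⟨by nlinarith [sq_nonneg (u 0), sq_nonneg (u 1)],
    by nlinarith [sq_nonneg (u 0), sq_nonneg (u 1)]⟩

theorem dot_self_ne {u : Fin 2 → ℝ} (hu : u ≠ 0) : dot u u ≠ 0 := (dot_self_pos hu).ne'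

theorem quarterTurn_ne {u : Fin 2 → ℝ} (hu : u ≠ 0) : quarterTurn u ≠ 0 := by
  intro h
  apply dot_self_ne hu
  have h0 := congrFun h 0
  have h1 := congrFun h 1
  simp at h0 h1
  simp [dot, h0, h1]

theorem exists_smul_of_area {u v : Fin 2 → ℝ} (hu : u ≠ 0) (h : area u v = 0) :
    ∃ c : ℝ, v = c • u := by
  have hd := dot_self_ne hu
  refine ⟨dot u v / dot u u, ?_⟩
  unfold area at h
  ext i
  fin_cases i
  · simp only [Pi.smul_apply, smul_eq_mul, Fin.zero_eta]
    field_simp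
    unfold dot
    linear_combination u 1 * (-h)
  · simp only [Pi.smul_apply, smul_eq_mul, Fin.mk_one]
    field_simp
    unfold dot
    linear_combination u 0 * h

theorem exists_smul_of_dot {u v : Fin 2 → ℝ} (hu : u ≠ 0) (h : dot u v = 0) :
    ∃ c : ℝ, v = c • quarterTurn u := by
  refine exists_smul_of_area (quarterTurn_ne hu) ?_
  simp only [area, quarterTurn_zero, quarterTurn_one]
  unfold dot at h
  linarith

theorem not_dot_of_area {u v : Fin 2 → ℝ} (hu : u ≠ 0) (hv : v ≠ 0) (h : area u v = 0) :
    dot u v ≠ 0 := by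
  obtain ⟨c, rfl⟩ := exists_smul_of_area hu h
  have hc : c ≠ 0 := by rintro rfl; simp at hv
  have : dot u (c • u) = c * dot u u := by simp [dot]; ring
  rw [this]
  exact mul_ne_zero hc (dot_self_ne hu)

theorem area_of_dot_dot {u v w : Fin 2 → ℝ} (hv : v ≠ 0) (h : dot u v = 0) (h' : dot v w = 0) :
    area u w = 0 := by
  rw [dot_comm] at h
  obtain ⟨c, rfl⟩ := exists_smul_of_dot hv h
  obtain ⟨d, rfl⟩ := exists_smul_of_dot hv h'
  simp [area]; ring

theorem dot_of_area_dot {u v w : Fin 2 → ℝ} (hv : v ≠ 0) (h : area u v = 0)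
    (h' : dot v w = 0) : dot u w = 0 := by
  rw [area_eq_zero_comm] at h
  obtain ⟨c, rfl⟩ := exists_smul_of_area hv h
  have : dot (c • v) w = c * dot v w := by simp [dot]; ring
  rw [this, h', mul_zero]

end Plane

/-! ### Tensors in coordinates -/

section Tensors

/-- The rank-one tensor `x ⊗ y ⊗ z` in coordinates. -/
def rankOne (x y z : Fin 2 → ℝ) : Fin 2 → Fin 2 → Fin 2 → ℝ := fun i j k => x i * y j * z k

/-- The cyclic rotation of the factors. -/
def rot (t : Fin 2 → Fin 2 → Fin 2 → ℝ) : Fin 2 → Fin 2 → Fin 2 → ℝ := fun i j k => t k i j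

theorem rot_rankOne (x y z : Fin 2 → ℝ) : rot (rankOne x y z) = rankOne y z x := by
  funext i j k; simp only [rot, rankOne]; ring

theorem rot_rot_rot (t : Fin 2 → Fin 2 → Fin 2 → ℝ) : rot (rot (rot t)) = t := rfl

theorem rot_injective : Function.Injective rot := fun s t h => by
  rw [← rot_rot_rot s, h, rot_rot_rot]

/-- The trilinear form of a tensor. -/
def form (t : Fin 2 → Fin 2 → Fin 2 → ℝ) (u v w : Fin 2 → ℝ) : ℝ :=
  ∑ i, ∑ j, ∑ k, t i j k * u i * v j * w k

/-- The Gram matrix of the first flattening. -/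
def gram (t : Fin 2 → Fin 2 → Fin 2 → ℝ) (p q : Fin 2) : ℝ := ∑ j, ∑ k, t p j k * t q j k

/-- The discriminant of the Gram matrix of the first flattening: it is nonzero exactly when the
Gram matrix has two different eigenvalues. -/
def gramDisc (t : Fin 2 → Fin 2 → Fin 2 → ℝ) : ℝ :=
  (gram t 0 0 - gram t 1 1) ^ 2 + (2 * gram t 0 1) ^ 2

/-- The quadratic form that vanishes exactly on the eigenvectors of the first Gram matrix. -/
def eigenForm (t : Fin 2 → Fin 2 → Fin 2 → ℝ) (u : Fin 2 → ℝ) : ℝ :=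
  2 * gram t 0 1 * (u 0 ^ 2 - u 1 ^ 2) - 2 * (gram t 0 0 - gram t 1 1) * (u 0 * u 1)

/-- The form vanishes when the double-angle vector `(u₀² - u₁², 2u₀u₁)` is parallel to `(A, B)`. Two
double angles parallel to the same nonzero vector differ by a multiple of `π`, and `dot u v * area u
v` is half the area of the two double-angle vectors. -/
theorem dot_or_area_of_eigenForm {t : Fin 2 → Fin 2 → Fin 2 → ℝ} (ht : gramDisc t ≠ 0)
    {u v : Fin 2 → ℝ} (hu : eigenForm t u = 0) (hv : eigenForm t v = 0) :
    dot u v = 0 ∨ area u v = 0 := by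
  rw [← mul_eq_zero]
  unfold eigenForm at hu hv
  unfold gramDisc at ht
  generalize gram t 0 0 - gram t 1 1 = A at *
  generalize 2 * gram t 0 1 = B at *
  apply (mul_eq_zero.mp _).resolve_left ht
  unfold dot area
  linear_combination (A / 2 * (v 0 ^ 2 - v 1 ^ 2) + B * (v 0 * v 1)) * hu -
    (A / 2 * (u 0 ^ 2 - u 1 ^ 2) + B * (u 0 * u 1)) * hv

variable {ι : Type*}

/-- A family of triples of nonzero plane vectors, any two of them orthogonal in two factors. -/
structure TwoOrthogonalFamily (x y z : ι → Fin 2 → ℝ) : Prop where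
  left_ne : ∀ i, x i ≠ 0
  mid_ne : ∀ i, y i ≠ 0
  right_ne : ∀ i, z i ≠ 0
  orthogonal : ∀ i j, i ≠ j → (dot (x i) (x j) = 0 ∧ dot (y i) (y j) = 0) ∨
    (dot (y i) (y j) = 0 ∧ dot (z i) (z j) = 0) ∨ (dot (z i) (z j) = 0 ∧ dot (x i) (x j) = 0)

variable {x y z : ι → Fin 2 → ℝ}

theorem TwoOrthogonalFamily.rot (h : TwoOrthogonalFamily x y z) : TwoOrthogonalFamily y z x :=
  ⟨h.2, h.3, h.1, fun i j hij => by have := h.4 i j hij; tauto⟩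

/-- Any two vectors of the family are orthogonal or parallel. -/
def Framed (x : ι → Fin 2 → ℝ) : Prop := ∀ i j, dot (x i) (x j) = 0 ∨ area (x i) (x j) = 0

/-- A family all of whose members are proportional to tensors `a ⊗ b ⊗ c`, `a ⊗ b' ⊗ c'`,
`a' ⊗ b ⊗ c'`, `a' ⊗ b' ⊗ c` of an orthogonal frame. -/
def EvenFamily (x y z : ι → Fin 2 → ℝ) : Prop :=
  ∀ i j, i ≠ j →
    (area (x i) (x j) = 0 ∧ dot (y i) (y j) = 0 ∧ dot (z i) (z j) = 0) ∨
    (dot (x i) (x j) = 0 ∧ area (y i) (y j) = 0 ∧ dot (z i) (z j) = 0) ∨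
    (dot (x i) (x j) = 0 ∧ dot (y i) (y j) = 0 ∧ area (z i) (z j) = 0)

/-- A family of two members that are orthogonal in the first two factors. -/
def PairFamily (x y : ι → Fin 2 → ℝ) : Prop :=
  ∃ i j, i ≠ j ∧ (∀ l, l = i ∨ l = j) ∧ dot (x i) (x j) = 0 ∧ dot (y i) (y j) = 0

/-- A third member `l` needs two orthogonal factors with `i` and two with `j`. No factor can serve
for both, since that would make its vectors at `i` and `j` parallel; three factors cannot supply
four relations. -/
theorem TwoOrthogonalFamily.pairFamily_of_not_area (h : TwoOrthogonalFamily x y z) {i j : ι}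
    (hij : i ≠ j) (hx : dot (x i) (x j) = 0) (hy : dot (y i) (y j) = 0)
    (hz : area (z i) (z j) ≠ 0) : PairFamily x y := by
  refine ⟨i, j, hij, fun l => ?_, hx, hy⟩
  by_contra! hl
  have nx : ¬ (dot (x i) (x l) = 0 ∧ dot (x l) (x j) = 0) := fun h' =>
    not_dot_of_area (h.1 i) (h.1 j) (area_of_dot_dot (h.1 l) h'.1 h'.2) hx
  have ny : ¬ (dot (y i) (y l) = 0 ∧ dot (y l) (y j) = 0) := fun h' =>
    not_dot_of_area (h.2 i) (h.2 j) (area_of_dot_dot (h.2 l) h'.1 h'.2) hy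
  have nz : ¬ (dot (z i) (z l) = 0 ∧ dot (z l) (z j) = 0) := fun h' =>
    hz (area_of_dot_dot (h.3 l) h'.1 h'.2)
  have h1 := h.4 i l hl.1.symm
  have h2 := h.4 l j hl.2
  tauto

theorem TwoOrthogonalFamily.classification (h : TwoOrthogonalFamily x y z) :
    EvenFamily x y z ∨ PairFamily x y ∨ PairFamily y z ∨ PairFamily z x := by
  by_contra! hc
  obtain ⟨h0, h1, h2, h3⟩ := hc
  apply h0
  intro i j hij
  rcases h.4 i j hij with ⟨ha, hb⟩ | ⟨ha, hb⟩ | ⟨ha, hb⟩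
  · by_cases hz : area (z i) (z j) = 0
    · tauto
    · exact absurd (h.pairFamily_of_not_area hij ha hb hz) h1
  · by_cases hz : area (x i) (x j) = 0
    · tauto
    · exact absurd (h.rot.pairFamily_of_not_area hij ha hb hz) h2
  · by_cases hz : area (y i) (y j) = 0
    · tauto
    · exact absurd (h.rot.rot.pairFamily_of_not_area hij ha hb hz) h3

theorem EvenFamily.rot (h : EvenFamily x y z) : EvenFamily y z x := fun i j hij => by
  have := h i j hij; tauto

theorem EvenFamily.framed (h : EvenFamily x y z) : Framed x := fun i j => by
  by_cases hij : i = j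
  · subst hij; exact Or.inr (area_self _)
  · have := h i j hij; tauto

theorem framed_of_pair {i j : ι} (hl : ∀ l, l = i ∨ l = j) (hx : dot (x i) (x j) = 0) :
    Framed x := fun k l => by
  rcases hl k with rfl | rfl <;> rcases hl l with rfl | rfl
  · exact Or.inr (area_self _)
  · exact Or.inl hx
  · exact Or.inl (by rw [dot_comm]; exact hx)
  · exact Or.inr (area_self _)

theorem PairFamily.framed_left (h : PairFamily x y) : Framed x := by
  obtain ⟨i, j, -, hl, hx, -⟩ := h
  exact framed_of_pair hl hx

theorem PairFamily.framed_right (h : PairFamily x y) : Framed y := by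
  obtain ⟨i, j, -, hl, -, hx⟩ := h
  exact framed_of_pair hl hx

theorem TwoOrthogonalFamily.framed_pairs (h : TwoOrthogonalFamily x y z) :
    (Framed x ∧ Framed y ∧ Framed z) ∨ PairFamily x y ∨ PairFamily y z ∨ PairFamily z x := by
  rcases h.classification with he | he
  · exact Or.inl ⟨he.framed, he.rot.framed, he.rot.rot.framed⟩
  · exact Or.inr he

theorem form_rankOne (a b c u v w : Fin 2 → ℝ) :
    form (rankOne a b c) u v w = dot a u * dot b v * dot c w := by
  simp [form, rankOne, dot, Fin.sum_univ_two]; ring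

theorem TwoOrthogonalFamily.rankOne_ne_zero (h : TwoOrthogonalFamily x y z) (i : ι) :
    rankOne (x i) (y i) (z i) ≠ 0 := by
  intro h0
  have e := form_rankOne (x i) (y i) (z i) (x i) (y i) (z i)
  refine mul_ne_zero (mul_ne_zero (dot_self_ne (h.1 i)) (dot_self_ne (h.2 i)))
    (dot_self_ne (h.3 i)) ?_
  rw [← e, h0]
  simp [form]

theorem TwoOrthogonalFamily.rankOne_injective (h : TwoOrthogonalFamily x y z) :
    Function.Injective fun i => rankOne (x i) (y i) (z i) := by
  intro i j hij
  by_contra hne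
  have e := congrArg (fun t => form t (x j) (y j) (z j)) hij
  simp only [form_rankOne] at e
  have n : dot (x j) (x j) * dot (y j) (y j) * dot (z j) (z j) ≠ 0 :=
    mul_ne_zero (mul_ne_zero (dot_self_ne (h.1 j)) (dot_self_ne (h.2 j))) (dot_self_ne (h.3 j))
  apply n
  rw [← e]
  rcases h.4 i j hne with ⟨h0, -⟩ | ⟨h0, -⟩ | ⟨h0, -⟩ <;> rw [h0] <;> ring

variable [Fintype ι]

/-- The sum of a family of rank-one tensors. -/
def sumRankOne (x y z : ι → Fin 2 → ℝ) : Fin 2 → Fin 2 → Fin 2 → ℝ :=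
  ∑ i, rankOne (x i) (y i) (z i)

theorem sumRankOne_apply (x y z : ι → Fin 2 → ℝ) (p q r : Fin 2) :
    sumRankOne x y z p q r = ∑ i, x i p * y i q * z i r := by
  simp [sumRankOne, rankOne, Finset.sum_apply]

theorem rot_sumRankOne (x y z : ι → Fin 2 → ℝ) :
    rot (sumRankOne x y z) = sumRankOne y z x := by
  funext i j k
  simp only [rot, sumRankOne_apply]
  exact Finset.sum_congr rfl fun _ _ => by ring

theorem form_sumRankOne (x y z : ι → Fin 2 → ℝ) (u v w : Fin 2 → ℝ) :
    form (sumRankOne x y z) u v w = ∑ i, dot (x i) u * dot (y i) v * dot (z i) w := by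
  simp only [form, sumRankOne_apply, Fin.sum_univ_two, Finset.sum_mul, ← Finset.sum_add_distrib]
  exact Finset.sum_congr rfl fun i _ => by unfold dot; ring

/-- Of any two orthogonal factors at least one is the second or third, so every cross term vanishes.
-/
theorem TwoOrthogonalFamily.gram_sumRankOne (h : TwoOrthogonalFamily x y z) (p q : Fin 2) :
    gram (sumRankOne x y z) p q =
      ∑ i, x i p * x i q * (dot (y i) (y i) * dot (z i) (z i)) := by
  have key : gram (sumRankOne x y z) p q =
      ∑ i, ∑ l, x i p * x l q * (dot (y i) (y l) * dot (z i) (z l)) := by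
    simp only [gram, sumRankOne_apply, Fin.sum_univ_two, Finset.sum_mul_sum,
      ← Finset.sum_add_distrib]
    exact Finset.sum_congr rfl fun i _ => Finset.sum_congr rfl fun l _ => by unfold dot; ring
  rw [key]
  refine Finset.sum_congr rfl fun i _ => ?_
  rw [Finset.sum_eq_single i]
  · intro l _ hl
    have : dot (y i) (y l) * dot (z i) (z l) = 0 := by
      rw [mul_eq_zero]; have := h.4 i l hl.symm; tauto
    rw [this, mul_zero]
  · simp

theorem TwoOrthogonalFamily.eigenForm_eq_zero (h : TwoOrthogonalFamily x y z) (hx : Framed x)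
    (i : ι) : eigenForm (sumRankOne x y z) (x i) = 0 := by
  have key : eigenForm (sumRankOne x y z) (x i) =
      ∑ l, 2 * (dot (x l) (x i) * area (x i) (x l)) * (dot (y l) (y l) * dot (z l) (z l)) := by
    simp only [eigenForm, h.gram_sumRankOne, ← Finset.sum_sub_distrib, Finset.mul_sum,
      Finset.sum_mul]
    exact Finset.sum_congr rfl fun l _ => by unfold dot area; ring
  rw [key]
  refine Finset.sum_eq_zero fun l _ => ?_
  have : dot (x l) (x i) * area (x i) (x l) = 0 := by
    rw [mul_eq_zero, area_eq_zero_comm]; exact hx l i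
  rw [this]; ring

end Tensors

/-! ### Uniqueness for Gram-regular tensors -/

section Uniqueness

variable {ι κ : Type*} [Fintype ι] [Fintype κ] {x y z : ι → Fin 2 → ℝ} {x' y' z' : κ → Fin 2 → ℝ}

theorem dot_smul_left (c : ℝ) (u v : Fin 2 → ℝ) : dot (c • u) v = c * dot u v := by
  simp [dot]; ring

theorem dot_smul_right (c : ℝ) (u v : Fin 2 → ℝ) : dot u (c • v) = c * dot u v := by
  simp [dot]; ring

theorem dot_quarterTurn (u v : Fin 2 → ℝ) : dot u (quarterTurn v) = -area u v := by
  simp [dot, area]; ring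

theorem TwoOrthogonalFamily.form_self (h : TwoOrthogonalFamily x y z) (i : ι) (w : Fin 2 → ℝ) :
    form (sumRankOne x y z) (x i) (y i) w =
      dot (x i) (x i) * dot (y i) (y i) * dot (z i) w := by
  rw [form_sumRankOne, Finset.sum_eq_single i _ (by simp)]
  intro l _ hl
  have : dot (x l) (x i) * dot (y l) (y i) = 0 := by
    rw [mul_eq_zero]; have := h.4 l i hl; tauto
  rw [this, zero_mul]

theorem form_smul_smul (t : Fin 2 → Fin 2 → Fin 2 → ℝ) (a b : ℝ) (u v w : Fin 2 → ℝ) :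
    form t (a • u) (b • v) w = a * b * form t u v w := by
  simp [form, Fin.sum_univ_two]; ring

theorem eq_of_forall_dot {u v : Fin 2 → ℝ} (h : ∀ w, dot u w = dot v w) : u = v := by
  ext i
  have h0 := h ![1, 0]
  have h1 := h ![0, 1]
  simp [dot] at h0 h1
  fin_cases i <;> assumption

theorem TwoOrthogonalFamily.exists_rankOne_eq (h : TwoOrthogonalFamily x y z)
    (h' : TwoOrthogonalFamily x' y' z') (hs : sumRankOne x y z = sumRankOne x' y' z')
    (hx : Framed x) (hy : Framed y) (hx' : Framed x') (hy' : Framed y')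
    (d₁ : gramDisc (sumRankOne x y z) ≠ 0) (d₂ : gramDisc (sumRankOne y z x) ≠ 0) (j : κ) :
    ∃ i, rankOne (x' j) (y' j) (z' j) = rankOne (x i) (y i) (z i) := by
  have hs₂ : sumRankOne y z x = sumRankOne y' z' x' := by
    rw [← rot_sumRankOne, hs, rot_sumRankOne]
  have e := h'.form_self j (z' j)
  have ne : form (sumRankOne x' y' z') (x' j) (y' j) (z' j) ≠ 0 := by
    rw [e]
    exact mul_ne_zero (mul_ne_zero (dot_self_ne (h'.1 j)) (dot_self_ne (h'.2 j)))
      (dot_self_ne (h'.3 j))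
  -- Pairing the tensor with the `j`-th summand of one decomposition is nonzero, so some summand `i`
  -- of the other is non-orthogonal to it in every factor. Between eigenvectors, not orthogonal
  -- means parallel.
  rw [← hs, form_sumRankOne] at ne
  obtain ⟨i, -, hi⟩ := Finset.exists_ne_zero_of_sum_ne_zero ne
  have hi₁ : dot (x i) (x' j) ≠ 0 := fun h0 => hi (by rw [h0]; ring)
  have hi₂ : dot (y i) (y' j) ≠ 0 := fun h0 => hi (by rw [h0]; ring)
  have a₁ := (dot_or_area_of_eigenForm d₁ (h.eigenForm_eq_zero hx i)
    (hs ▸ h'.eigenForm_eq_zero hx' j)).resolve_left hi₁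
  have a₂ := (dot_or_area_of_eigenForm d₂ (h.rot.eigenForm_eq_zero hy i)
    (hs₂ ▸ h'.rot.eigenForm_eq_zero hy' j)).resolve_left hi₂
  obtain ⟨a, ha⟩ := exists_smul_of_area (h.1 i) a₁
  obtain ⟨b, hb⟩ := exists_smul_of_area (h.2 i) a₂
  have ha0 : a ≠ 0 := by rintro rfl; exact h'.1 j (by simp [ha])
  have hb0 : b ≠ 0 := by rintro rfl; exact h'.2 j (by simp [hb])
  have hz : z i = (a * b) • z' j := by
    refine eq_of_forall_dot fun w => ?_
    have e₁ := h.form_self i w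
    have e₂ := h'.form_self j w
    rw [← hs, ha, hb, form_smul_smul, e₁] at e₂
    simp only [dot_smul_left, dot_smul_right] at e₂ ⊢
    have n₁ := dot_self_ne (h.1 i)
    have n₂ := dot_self_ne (h.2 i)
    have : (a * b * (dot (x i) (x i) * dot (y i) (y i))) * dot (z i) w =
      (a * b * (dot (x i) (x i) * dot (y i) (y i))) * (a * b * dot (z' j) w) := by
      linear_combination e₂
    exact mul_left_cancel₀ (by positivity) this
  refine ⟨i, ?_⟩
  funext p q r
  simp only [rankOne, ha, hb, hz, Pi.smul_apply, smul_eq_mul]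
  ring

/-- Contraction with `x i`, `y i` and the quarter turn of `z' k` isolates one summand on each side.
The right one is zero, the left one a nonzero multiple of the area. -/
theorem TwoOrthogonalFamily.area_right_of_area_mid (h : TwoOrthogonalFamily x y z)
    (hs : sumRankOne x y z = sumRankOne x' y' z') {i : ι} {k : κ}
    (hi : ∀ m, m ≠ i → dot (y m) (y i) = 0) (hk : ∀ m, m ≠ k → dot (y' m) (y' k) = 0)
    (hk0 : y' k ≠ 0) (hik : area (y i) (y' k) = 0) : area (z i) (z' k) = 0 := by
  have e := congrArg (fun t => form t (x i) (y i) (quarterTurn (z' k))) hs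
  simp only [form_sumRankOne] at e
  rw [Finset.sum_eq_single i (fun m _ hm => by rw [hi m hm]; ring) (by simp),
    Finset.sum_eq_single k (fun m _ hm => by
      rw [dot_comm (y' m), dot_of_area_dot hk0 hik (by rw [dot_comm]; exact hk m hm)]; ring)
      (by simp), dot_quarterTurn_self, mul_zero, dot_quarterTurn] at e
  have n₁ := dot_self_ne (h.1 i)
  have n₂ := dot_self_ne (h.2 i)
  simpa [n₁, n₂] using e

/-- This handles pairs of different types, which share only one framed factor. Matching the lines
there forces the third factors to match, and so transfers their orthogonality. -/
theorem TwoOrthogonalFamily.framed_right_of_pairFamily (h : TwoOrthogonalFamily x y z)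
    (h' : TwoOrthogonalFamily x' y' z') (hs : sumRankOne x y z = sumRankOne x' y' z')
    (d₂ : gramDisc (sumRankOne y z x) ≠ 0) (hp : PairFamily x y) (hp' : PairFamily y' z') :
    Framed z := by
  have hs₂ : sumRankOne y z x = sumRankOne y' z' x' := by
    rw [← rot_sumRankOne, hs, rot_sumRankOne]
  have fy := hp.framed_right
  have fy' := hp'.framed_left
  obtain ⟨i, j, hij, hl, -, hy⟩ := hp
  obtain ⟨k, l, hkl, hl', hy', hz'⟩ := hp'
  have key : ∀ k l, (∀ m, m = k ∨ m = l) → dot (y' k) (y' l) = 0 → dot (z' k) (z' l) = 0 →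
      area (y i) (y' k) = 0 → Framed z := by
    intro k l hl' hy' hz' ha
    have ha' : area (y j) (y' l) = 0 :=
      area_of_dot_dot (h.2 i) (by rw [dot_comm]; exact hy) (dot_of_area_dot (h'.2 k) ha hy')
    have b := h.area_right_of_area_mid hs (i := i) (k := k)
      (fun m hm => by rw [(hl m).resolve_left hm, dot_comm]; exact hy)
      (fun m hm => by rw [(hl' m).resolve_left hm, dot_comm]; exact hy') (h'.2 k) ha
    have b' := h.area_right_of_area_mid hs (i := j) (k := l)
      (fun m hm => by rw [(hl m).resolve_right hm]; exact hy)
      (fun m hm => by rw [(hl' m).resolve_right hm]; exact hy') (h'.2 l) ha'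
    refine framed_of_pair hl (dot_of_area_dot (h'.3 k) b ?_)
    rw [dot_comm] at hz' ⊢
    exact dot_of_area_dot (h'.3 l) b' hz'
  rcases dot_or_area_of_eigenForm d₂ (h.rot.eigenForm_eq_zero fy i)
    (hs₂ ▸ h'.rot.eigenForm_eq_zero fy' k) with hd | hd
  · exact key l k (fun m => (hl' m).symm) (by rw [dot_comm]; exact hy')
      (by rw [dot_comm]; exact hz') (area_of_dot_dot (h'.2 k) hd hy')
  · exact key k l hl' hy' hz' hd

/-- All three flattenings have Gram matrices with two different eigenvalues. -/
def GramRegular (t : Fin 2 → Fin 2 → Fin 2 → ℝ) : Prop :=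
  gramDisc t ≠ 0 ∧ gramDisc (rot t) ≠ 0 ∧ gramDisc (rot (rot t)) ≠ 0

theorem TwoOrthogonalFamily.rankOne_mem (h : TwoOrthogonalFamily x y z)
    (h' : TwoOrthogonalFamily x' y' z') (hs : sumRankOne x y z = sumRankOne x' y' z')
    (hd : GramRegular (sumRankOne x y z)) (j : κ) :
    ∃ i, rankOne (x' j) (y' j) (z' j) = rankOne (x i) (y i) (z i) := by
  obtain ⟨d₁, d₂, d₃⟩ := hd
  rw [rot_sumRankOne] at d₂ d₃
  rw [rot_sumRankOne] at d₃
  have hs₂ : sumRankOne y z x = sumRankOne y' z' x' := by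
    rw [← rot_sumRankOne, hs, rot_sumRankOne]
  have hs₃ : sumRankOne z x y = sumRankOne z' x' y' := by
    rw [← rot_sumRankOne, hs₂, rot_sumRankOne]
  have c₁₂ : Framed x → Framed y → Framed x' → Framed y' →
      ∃ i, rankOne (x' j) (y' j) (z' j) = rankOne (x i) (y i) (z i) := fun f₁ f₂ g₁ g₂ =>
    h.exists_rankOne_eq h' hs f₁ f₂ g₁ g₂ d₁ d₂ j
  have c₂₃ : Framed y → Framed z → Framed y' → Framed z' →
      ∃ i, rankOne (x' j) (y' j) (z' j) = rankOne (x i) (y i) (z i) := fun f₁ f₂ g₁ g₂ => by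
    obtain ⟨i, hi⟩ := h.rot.exists_rankOne_eq h'.rot hs₂ f₁ f₂ g₁ g₂ d₂ d₃ j
    exact ⟨i, rot_injective (by rw [rot_rankOne, rot_rankOne, hi])⟩
  have c₃₁ : Framed z → Framed x → Framed z' → Framed x' →
      ∃ i, rankOne (x' j) (y' j) (z' j) = rankOne (x i) (y i) (z i) := fun f₁ f₂ g₁ g₂ => by
    obtain ⟨i, hi⟩ := h.rot.rot.exists_rankOne_eq h'.rot.rot hs₃ f₁ f₂ g₁ g₂ d₃ d₁ j
    exact ⟨i, by rw [← rot_rankOne, hi, rot_rankOne]⟩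
  -- In every case two factors can be found that are framed in both families; if the pair types
  -- differ, the second one comes from `framed_right_of_pairFamily`.
  rcases h.framed_pairs with ⟨f₁, f₂, f₃⟩ | f | f | f <;>
  rcases h'.framed_pairs with ⟨g₁, g₂, g₃⟩ | g | g | g
  · exact c₁₂ f₁ f₂ g₁ g₂
  · exact c₁₂ f₁ f₂ g.framed_left g.framed_right
  · exact c₂₃ f₂ f₃ g.framed_left g.framed_right
  · exact c₃₁ f₃ f₁ g.framed_left g.framed_right
  · exact c₁₂ f.framed_left f.framed_right g₁ g₂
  · exact c₁₂ f.framed_left f.framed_right g.framed_left g.framed_right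
  · exact c₂₃ f.framed_right (h.framed_right_of_pairFamily h' hs d₂ f g) g.framed_left
      g.framed_right
  · exact c₁₂ f.framed_left f.framed_right g.framed_right
      (h'.rot.rot.framed_right_of_pairFamily h.rot.rot hs₃.symm (hs ▸ d₁) g f)
  · exact c₂₃ f.framed_left f.framed_right g₂ g₃
  · exact c₂₃ f.framed_left f.framed_right g.framed_right
      (h'.framed_right_of_pairFamily h hs.symm (hs₂ ▸ d₂) g f)
  · exact c₂₃ f.framed_left f.framed_right g.framed_left g.framed_right
  · exact c₃₁ f.framed_right (h.rot.framed_right_of_pairFamily h'.rot hs₂ d₃ f g) g.framed_left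
      g.framed_right
  · exact c₃₁ f.framed_left f.framed_right g₃ g₁
  · exact c₁₂ f.framed_right (h.rot.rot.framed_right_of_pairFamily h'.rot.rot hs₃ d₁ f g)
      g.framed_left g.framed_right
  · exact c₃₁ f.framed_left f.framed_right g.framed_right
      (h'.rot.framed_right_of_pairFamily h.rot hs₂.symm (hs₃ ▸ d₃) g f)
  · exact c₃₁ f.framed_left f.framed_right g.framed_left g.framed_right

theorem TwoOrthogonalFamily.exists_equiv (h : TwoOrthogonalFamily x y z)
    (h' : TwoOrthogonalFamily x' y' z') (hs : sumRankOne x y z = sumRankOne x' y' z')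
    (hd : GramRegular (sumRankOne x y z)) :
    ∃ σ : κ ≃ ι, ∀ j, rankOne (x' j) (y' j) (z' j) =
      rankOne (x (σ j)) (y (σ j)) (z (σ j)) := by
  choose f hf using h.rankOne_mem h' hs hd
  choose g hg using h'.rankOne_mem h hs.symm (hs ▸ hd)
  refine ⟨⟨f, g, fun j => h'.rankOne_injective ?_, fun i => h.rankOne_injective ?_⟩, hf⟩
  · exact ((hf j).trans (hg (f j))).symm
  · exact ((hg i).trans (hf (g i))).symm

end Uniqueness

/-! ### Discarding zero summands -/

section Restriction

variable {κ : Type*}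

theorem TwoOrthogonalFamily.restrict {x y z : κ → Fin 2 → ℝ}
    (ho : ∀ i j, i ≠ j → rankOne (x i) (y i) (z i) ≠ 0 → rankOne (x j) (y j) (z j) ≠ 0 →
      (dot (x i) (x j) = 0 ∧ dot (y i) (y j) = 0) ∨
      (dot (y i) (y j) = 0 ∧ dot (z i) (z j) = 0) ∨
      (dot (z i) (z j) = 0 ∧ dot (x i) (x j) = 0)) :
    TwoOrthogonalFamily (fun i : {i // rankOne (x i) (y i) (z i) ≠ 0} => x i)
      (fun i => y i) (fun i => z i) := by
  refine ⟨fun i h => i.2 ?_, fun i h => i.2 ?_, fun i h => i.2 ?_,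
    fun i j hij => ho i j (Subtype.coe_injective.ne hij) i.2 j.2⟩ <;>
  · funext p q r; simp [rankOne, h]

open scoped Classical in
theorem sumRankOne_restrict [Fintype κ] (x y z : κ → Fin 2 → ℝ) :
    sumRankOne (fun i : {i // rankOne (x i) (y i) (z i) ≠ 0} => x i)
      (fun i => y i) (fun i => z i) = sumRankOne x y z := by
  unfold sumRankOne
  refine Eq.trans ?_ (Finset.sum_filter_ne_zero Finset.univ)
  exact (Finset.sum_subtype (p := fun i => rankOne (x i) (y i) (z i) ≠ 0)
    (Finset.univ.filter fun i => rankOne (x i) (y i) (z i) ≠ 0) (by simp)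
    fun i => rankOne (x i) (y i) (z i)).symm

end Restriction

/-! ### Alignment with the reflections of the Gram matrices -/

section Alignment

/-- Twice the traceless part of the first Gram matrix, a multiple of a reflection. -/
def scaledReflection (t : Fin 2 → Fin 2 → Fin 2 → ℝ) : (Fin 2 → ℝ) →ₗ[ℝ] (Fin 2 → ℝ) :=
  Matrix.mulVecLin !![gram t 0 0 - gram t 1 1, 2 * gram t 0 1;
    2 * gram t 0 1, -(gram t 0 0 - gram t 1 1)]

theorem scaledReflection_zero (t : Fin 2 → Fin 2 → Fin 2 → ℝ) (u : Fin 2 → ℝ) :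
    scaledReflection t u 0 = (gram t 0 0 - gram t 1 1) * u 0 + 2 * gram t 0 1 * u 1 := by
  simp [scaledReflection, Matrix.mulVec, dotProduct, Fin.sum_univ_two]

theorem scaledReflection_one (t : Fin 2 → Fin 2 → Fin 2 → ℝ) (u : Fin 2 → ℝ) :
    scaledReflection t u 1 = 2 * gram t 0 1 * u 0 - (gram t 0 0 - gram t 1 1) * u 1 := by
  simp [scaledReflection, Matrix.mulVec, dotProduct, Fin.sum_univ_two]; ring

/-- The Rayleigh quotient of the scaled reflection. -/
noncomputable def rayleigh (t : Fin 2 → Fin 2 → Fin 2 → ℝ) (u : Fin 2 → ℝ) : ℝ :=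
  dot u (scaledReflection t u) / dot u u

theorem rayleigh_of_area {t : Fin 2 → Fin 2 → Fin 2 → ℝ} {u v : Fin 2 → ℝ} (hu : u ≠ 0)
    (hv : v ≠ 0) (h : area u v = 0) : rayleigh t v = rayleigh t u := by
  obtain ⟨c, rfl⟩ := exists_smul_of_area hu h
  have hc : c ≠ 0 := by rintro rfl; simp at hv
  simp only [rayleigh, map_smul, dot_smul_left, dot_smul_right]
  have := dot_self_ne hu
  field_simp

/-- A traceless form takes opposite values on the two vectors of an orthonormal frame. -/
theorem rayleigh_of_dot {t : Fin 2 → Fin 2 → Fin 2 → ℝ} {u v : Fin 2 → ℝ} (hu : u ≠ 0)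
    (hv : v ≠ 0) (h : dot u v = 0) : rayleigh t v = -rayleigh t u := by
  obtain ⟨c, rfl⟩ := exists_smul_of_dot hu h
  have hc : c ≠ 0 := by rintro rfl; simp at hv
  have e : dot (quarterTurn u) (quarterTurn u) = dot u u := by simp [dot]; ring
  simp only [rayleigh, map_smul, dot_smul_left, dot_smul_right, e]
  have := dot_self_ne hu
  field_simp
  simp only [dot, scaledReflection_zero, scaledReflection_one, quarterTurn_zero, quarterTurn_one]
  ring

theorem dot_scaledReflection {t : Fin 2 → Fin 2 → Fin 2 → ℝ} {x : Fin 2 → ℝ} (hx : x ≠ 0)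
    (h : eigenForm t x = 0) (u : Fin 2 → ℝ) :
    dot x (scaledReflection t u) = rayleigh t x * dot x u := by
  have ha : area x (scaledReflection t x) = 0 := by
    rw [← h]
    simp only [area, eigenForm, scaledReflection_zero, scaledReflection_one]
    ring
  obtain ⟨c, hc⟩ := exists_smul_of_area hx ha
  have hr : rayleigh t x = c := by
    rw [rayleigh, hc, dot_smul_right, mul_div_assoc, div_self (dot_self_ne hx), mul_one]
  have hs : dot x (scaledReflection t u) = dot (scaledReflection t x) u := by
    simp only [dot, scaledReflection_zero, scaledReflection_one]
    ring
  rw [hs, hc, dot_smul_left, hr]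

/-- The sum of the squares of the minors of the pair `t`, `(A ⊗ B ⊗ C)ᵀ t`. -/
def alignDefect (t : Fin 2 → Fin 2 → Fin 2 → ℝ) (A B C : (Fin 2 → ℝ) →ₗ[ℝ] (Fin 2 → ℝ)) : ℝ :=
  ∑ s : (Fin 2 × Fin 2 × Fin 2) × (Fin 2 × Fin 2 × Fin 2),
    (form t (A (Pi.single s.1.1 1)) (B (Pi.single s.1.2.1 1)) (C (Pi.single s.1.2.2 1)) *
        t s.2.1 s.2.2.1 s.2.2.2 -
      form t (A (Pi.single s.2.1 1)) (B (Pi.single s.2.2.1 1)) (C (Pi.single s.2.2.2 1)) *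
        t s.1.1 s.1.2.1 s.1.2.2) ^ 2

/-- `t` is an eigenvector of `(A ⊗ B ⊗ C)ᵀ` with eigenvalue `μ`. -/
def IsAligned (t : Fin 2 → Fin 2 → Fin 2 → ℝ) (A B C : (Fin 2 → ℝ) →ₗ[ℝ] (Fin 2 → ℝ))
    (μ : ℝ) : Prop :=
  ∀ u v w, form t (A u) (B v) (C w) = μ * form t u v w

theorem form_single (t : Fin 2 → Fin 2 → Fin 2 → ℝ) (i j k : Fin 2) :
    form t (Pi.single i 1) (Pi.single j 1) (Pi.single k 1) = t i j k := by
  simp [form, Pi.single_apply]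

variable {t : Fin 2 → Fin 2 → Fin 2 → ℝ} {A B C : (Fin 2 → ℝ) →ₗ[ℝ] (Fin 2 → ℝ)}

theorem IsAligned.alignDefect_eq_zero {μ : ℝ} (h : IsAligned t A B C μ) :
    alignDefect t A B C = 0 := by
  refine Finset.sum_eq_zero fun s _ => ?_
  rw [h, h, form_single, form_single]
  ring

theorem form_map_eq_sum (t : Fin 2 → Fin 2 → Fin 2 → ℝ)
    (A B C : (Fin 2 → ℝ) →ₗ[ℝ] (Fin 2 → ℝ)) (u v w : Fin 2 → ℝ) :
    form t (A u) (B v) (C w) = ∑ i, ∑ j, ∑ k, u i * v j * w k *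
      form t (A (Pi.single i 1)) (B (Pi.single j 1)) (C (Pi.single k 1)) := by
  have e : ∀ (A : (Fin 2 → ℝ) →ₗ[ℝ] (Fin 2 → ℝ)) (u : Fin 2 → ℝ),
      A u = u 0 • A (Pi.single 0 1) + u 1 • A (Pi.single 1 1) := fun A u => by
    rw [← map_smul, ← map_smul, ← map_add]
    congr 1
    ext i
    fin_cases i <;> simp
  rw [e A u, e B v, e C w]
  simp only [form, Fin.sum_univ_two, Pi.add_apply, Pi.smul_apply, smul_eq_mul]
  ring

/-- Over the reals a vanishing sum of squares makes every minor vanish, so the transformed tensor is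
proportional to `t`; a nonzero entry of `t` gives the factor. -/
theorem exists_isAligned (ht : t ≠ 0) (h : alignDefect t A B C = 0) :
    ∃ μ, IsAligned t A B C μ := by
  obtain ⟨i, j, k, hn⟩ : ∃ i j k, t i j k ≠ 0 := by
    by_contra! hc
    exact ht (by funext i j k; exact hc i j k)
  rw [alignDefect, Finset.sum_eq_zero_iff_of_nonneg fun _ _ => sq_nonneg _] at h
  refine ⟨form t (A (Pi.single i 1)) (B (Pi.single j 1)) (C (Pi.single k 1)) / t i j k,
    fun u v w => ?_⟩
  have e : form t u v w = ∑ i, ∑ j, ∑ k, u i * v j * w k * t i j k := by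
    simp only [form]
    exact Finset.sum_congr rfl fun _ _ => Finset.sum_congr rfl fun _ _ =>
      Finset.sum_congr rfl fun _ _ => by ring
  rw [form_map_eq_sum, e]
  simp only [Finset.mul_sum]
  refine Finset.sum_congr rfl fun i' _ => Finset.sum_congr rfl fun j' _ =>
    Finset.sum_congr rfl fun k' _ => ?_
  have := h ((i', j', k'), (i, j, k)) (Finset.mem_univ _)
  have := pow_eq_zero_iff (two_ne_zero) |>.mp this
  dsimp only at this
  field_simp
  linear_combination u i' * v j' * w k' * this

end Alignment

/-! ### Vanishing of the defects on two-orthogonal sums -/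

section AlignedFamilies

variable {ι : Type*} [Fintype ι] {x y z : ι → Fin 2 → ℝ}

/-- The defect that detects sums of even families. -/
def evenDefect (t : Fin 2 → Fin 2 → Fin 2 → ℝ) : ℝ :=
  alignDefect t (scaledReflection t) (scaledReflection (rot t)) (scaledReflection (rot (rot t)))

/-- The defect that detects sums of two rank-one tensors orthogonal in the first two factors. -/
def pairDefect (t : Fin 2 → Fin 2 → Fin 2 → ℝ) : ℝ :=
  alignDefect t (scaledReflection t) (scaledReflection (rot t)) LinearMap.id

theorem TwoOrthogonalFamily.evenDefect_eq_zero (h : TwoOrthogonalFamily x y z)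
    (he : EvenFamily x y z) : evenDefect (sumRankOne x y z) = 0 := by
  have ex := h.eigenForm_eq_zero he.framed
  have ey := h.rot.eigenForm_eq_zero he.rot.framed
  have ez := h.rot.rot.eigenForm_eq_zero he.rot.rot.framed
  simp only [evenDefect, rot_sumRankOne]
  have hf := form_sumRankOne x y z
  generalize sumRankOne x y z = r₁ at *
  generalize sumRankOne y z x = r₂ at *
  generalize sumRankOne z x y = r₃ at *
  -- Passing from one member to another changes the sign of exactly two of the three eigenvalues, so
  -- the product is constant.
  have hc : ∃ μ, ∀ i, rayleigh r₁ (x i) * rayleigh r₂ (y i) * rayleigh r₃ (z i) = μ := by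
    rcases isEmpty_or_nonempty ι with hι | ⟨⟨o⟩⟩
    · exact ⟨0, fun i => hι.elim i⟩
    · refine ⟨rayleigh r₁ (x o) * rayleigh r₂ (y o) * rayleigh r₃ (z o), fun i => ?_⟩
      by_cases hi : o = i
      · rw [hi]
      rcases he o i hi with ⟨a, b, c⟩ | ⟨a, b, c⟩ | ⟨a, b, c⟩
      · rw [rayleigh_of_area (h.1 o) (h.1 i) a, rayleigh_of_dot (h.2 o) (h.2 i) b,
          rayleigh_of_dot (h.3 o) (h.3 i) c]; ring
      · rw [rayleigh_of_dot (h.1 o) (h.1 i) a, rayleigh_of_area (h.2 o) (h.2 i) b,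
          rayleigh_of_dot (h.3 o) (h.3 i) c]; ring
      · rw [rayleigh_of_dot (h.1 o) (h.1 i) a, rayleigh_of_dot (h.2 o) (h.2 i) b,
          rayleigh_of_area (h.3 o) (h.3 i) c]; ring
  obtain ⟨μ, hμ⟩ := hc
  refine IsAligned.alignDefect_eq_zero (μ := μ) fun u v w => ?_
  rw [hf, hf, Finset.mul_sum]
  refine Finset.sum_congr rfl fun i _ => ?_
  rw [dot_scaledReflection (h.1 i) (ex i), dot_scaledReflection (h.2 i) (ey i),
    dot_scaledReflection (h.3 i) (ez i), ← hμ i]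
  ring

theorem TwoOrthogonalFamily.pairDefect_eq_zero (h : TwoOrthogonalFamily x y z)
    (hp : PairFamily x y) : pairDefect (sumRankOne x y z) = 0 := by
  have ex := h.eigenForm_eq_zero hp.framed_left
  have ey := h.rot.eigenForm_eq_zero hp.framed_right
  simp only [pairDefect, rot_sumRankOne]
  have hf := form_sumRankOne x y z
  generalize sumRankOne x y z = r₁ at *
  generalize sumRankOne y z x = r₂ at *
  obtain ⟨o, j, -, hl, hx, hy⟩ := hp
  have hμ : ∀ i, rayleigh r₁ (x i) * rayleigh r₂ (y i) =
      rayleigh r₁ (x o) * rayleigh r₂ (y o) := by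
    intro i
    rcases hl i with rfl | rfl
    · rfl
    · rw [rayleigh_of_dot (h.1 o) (h.1 i) hx, rayleigh_of_dot (h.2 o) (h.2 i) hy]; ring
  refine IsAligned.alignDefect_eq_zero (μ := rayleigh r₁ (x o) * rayleigh r₂ (y o))
    fun u v w => ?_
  rw [hf, hf, Finset.mul_sum]
  refine Finset.sum_congr rfl fun i _ => ?_
  rw [dot_scaledReflection (h.1 i) (ex i), dot_scaledReflection (h.2 i) (ey i), ← hμ i]
  simp only [LinearMap.id_apply]
  ring

/-- The product of all defects: it vanishes on all two-orthogonal sums. -/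
def totalDefect (t : Fin 2 → Fin 2 → Fin 2 → ℝ) : ℝ :=
  evenDefect t * (pairDefect t * pairDefect (rot t) * pairDefect (rot (rot t)))

theorem TwoOrthogonalFamily.totalDefect_eq_zero (h : TwoOrthogonalFamily x y z) :
    totalDefect (sumRankOne x y z) = 0 := by
  unfold totalDefect
  rcases h.classification with he | he | he | he
  · rw [h.evenDefect_eq_zero he]; ring
  · rw [h.pairDefect_eq_zero he]; ring
  · rw [rot_sumRankOne, h.rot.pairDefect_eq_zero he]; ring
  · rw [rot_sumRankOne, rot_sumRankOne, h.rot.rot.pairDefect_eq_zero he]; ring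

end AlignedFamilies

/-! ### Existence of decompositions -/

section Existence

/-- `t` is a sum of nonzero rank-one tensors, any two of them orthogonal in two factors. -/
def HasTwoOrthogonalFamily (t : Fin 2 → Fin 2 → Fin 2 → ℝ) : Prop :=
  ∃ (ι : Type) (_ : Fintype ι) (x y z : ι → Fin 2 → ℝ),
    TwoOrthogonalFamily x y z ∧ sumRankOne x y z = t

theorem HasTwoOrthogonalFamily.of_rot {t : Fin 2 → Fin 2 → Fin 2 → ℝ}
    (h : HasTwoOrthogonalFamily (rot t)) : HasTwoOrthogonalFamily t := by
  obtain ⟨ι, _, x, y, z, h, e⟩ := h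
  exact ⟨ι, _, z, x, y, h.rot.rot, by rw [← rot_sumRankOne, ← rot_sumRankOne, e, rot_rot_rot]⟩

/-- The orthonormal frame `a`, `J a` of a unit vector `a`. -/
def frame (a : Fin 2 → ℝ) : Fin 2 → Fin 2 → ℝ := ![a, quarterTurn a]

/-- The signs `1`, `-1`. -/
def frameSign : Fin 2 → ℝ := ![1, -1]

theorem eq_sum_frame {a : Fin 2 → ℝ} (ha : dot a a = 1) (f : Fin 2 → ℝ) (p : Fin 2) :
    f p = ∑ i, dot f (frame a i) * frame a i p := by
  unfold dot at ha
  simp only [Fin.sum_univ_two, frame, Matrix.cons_val_zero, Matrix.cons_val_one, dot,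
    quarterTurn_zero, quarterTurn_one]
  fin_cases p <;> simp
  · linear_combination (-f 0) * ha
  · linear_combination (-f 1) * ha

theorem dot_frame_of_ne {a : Fin 2 → ℝ} {i j : Fin 2} (h : i ≠ j) :
    dot (frame a i) (frame a j) = 0 := by
  fin_cases i <;> fin_cases j <;> simp [frame, dot] at h ⊢ <;> ring

/-- A frame of eigenvectors of a scaled reflection with nonzero eigenvalues `h`, `-h`. -/
theorem exists_eigenframe {t : Fin 2 → Fin 2 → Fin 2 → ℝ} (ht : gramDisc t ≠ 0) :
    ∃ (a : Fin 2 → ℝ) (h : ℝ), dot a a = 1 ∧ h ≠ 0 ∧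
      ∀ i, scaledReflection t (frame a i) = (frameSign i * h) • frame a i := by
  obtain ⟨A, hA⟩ : ∃ A, A = gram t 0 0 - gram t 1 1 := ⟨_, rfl⟩
  obtain ⟨B, hB⟩ : ∃ B, B = 2 * gram t 0 1 := ⟨_, rfl⟩
  have hd : A ^ 2 + B ^ 2 ≠ 0 := by rw [hA, hB]; exact ht
  set ζ : ℂ := ⟨A, B⟩ with hζ
  -- With `A + iB = ‖ζ‖ exp(2iθ)`, the matrix is `‖ζ‖` times the reflection in the line at angle
  -- `θ`.
  set θ := ζ.arg / 2 with hθ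
  have e₂ : 2 * θ = ζ.arg := by rw [hθ]; ring
  have cA : A = ‖ζ‖ * (2 * Real.cos θ ^ 2 - 1) := by
    rw [← Real.cos_two_mul, e₂, Complex.norm_mul_cos_arg]
  have cB : B = ‖ζ‖ * (2 * Real.sin θ * Real.cos θ) := by
    rw [← Real.sin_two_mul, e₂, Complex.norm_mul_sin_arg]
  have hsc := Real.sin_sq_add_cos_sq θ
  refine ⟨![Real.cos θ, Real.sin θ], ‖ζ‖, ?_, ?_, fun i => ?_⟩
  · simp only [dot, Matrix.cons_val_zero, Matrix.cons_val_one]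
    linarith
  · intro h0
    rw [h0] at cA cB
    apply hd
    rw [cA, cB]; ring
  · ext p
    fin_cases i <;> fin_cases p <;>
    simp [scaledReflection_zero, scaledReflection_one, frame, frameSign, ← hA, ← hB] <;>
    rw [cA, cB]
    · linear_combination (2 * ‖ζ‖ * Real.cos θ) * hsc
    · ring
    · ring
    · linear_combination (-2 * ‖ζ‖ * Real.cos θ) * hsc

theorem form_smul_third (t : Fin 2 → Fin 2 → Fin 2 → ℝ) (c : ℝ) (u v w : Fin 2 → ℝ) :
    form t u v (c • w) = c * form t u v w := by
  simp [form, Fin.sum_univ_two]; ring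

theorem form_eq_dot (t : Fin 2 → Fin 2 → Fin 2 → ℝ) (u v w : Fin 2 → ℝ) :
    form t u v w = dot (fun r => dot (fun q => dot (fun p => t p q r) u) v) w := by
  simp only [form, dot, Fin.sum_univ_two]; ring

theorem ne_zero_of_gramDisc {t : Fin 2 → Fin 2 → Fin 2 → ℝ} (ht : gramDisc t ≠ 0) : t ≠ 0 := by
  rintro rfl
  simp [gramDisc, gram] at ht

/-- Equal sign products mean that an even number of indices differ: none or two. -/
theorem frameSign_parity {h : ℝ} (hh : h ≠ 0) {i j k i' j' k' : Fin 2}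
    (e : frameSign i * frameSign j * frameSign k * h =
      frameSign i' * frameSign j' * frameSign k' * h) :
    (i, j, k) = (i', j', k') ∨ (i ≠ i' ∧ j ≠ j') ∨ (j ≠ j' ∧ k ≠ k') ∨ (k ≠ k' ∧ i ≠ i') := by
  have e' := mul_right_cancel₀ hh e
  clear e
  fin_cases i <;> fin_cases j <;> fin_cases k <;> fin_cases i' <;> fin_cases j' <;>
    fin_cases k' <;> simp [frameSign] at e' ⊢ <;> norm_num at e'

theorem hasTwoOrthogonalFamily_of_evenDefect {t : Fin 2 → Fin 2 → Fin 2 → ℝ}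
    (ht : GramRegular t) (h : evenDefect t = 0) : HasTwoOrthogonalFamily t := by
  obtain ⟨d₁, d₂, d₃⟩ := ht
  obtain ⟨μ, hμ⟩ := exists_isAligned (ne_zero_of_gramDisc d₁) h
  obtain ⟨a, α, ha, hα, ea⟩ := exists_eigenframe d₁
  obtain ⟨b, β, hb, hβ, eb⟩ := exists_eigenframe d₂
  obtain ⟨c, γ, hc, hγ, ec⟩ := exists_eigenframe d₃
  let s : Fin 2 × Fin 2 × Fin 2 → ℝ := fun m => form t (frame a m.1) (frame b m.2.1) (frame c m.2.2)
  let x : Fin 2 × Fin 2 × Fin 2 → Fin 2 → ℝ := fun m => frame a m.1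
  let y : Fin 2 × Fin 2 × Fin 2 → Fin 2 → ℝ := fun m => frame b m.2.1
  -- The coefficient of `t` in the eigenframe basis is absorbed into the third factor.
  let z : Fin 2 × Fin 2 × Fin 2 → Fin 2 → ℝ := fun m => s m • frame c m.2.2
  have hsgn : ∀ m, rankOne (x m) (y m) (z m) ≠ 0 →
      frameSign m.1 * frameSign m.2.1 * frameSign m.2.2 * (α * β * γ) = μ := by
    intro m hm
    have hs : s m ≠ 0 := fun h0 => hm (by funext p q r; simp [rankOne, z, h0])
    have := hμ (frame a m.1) (frame b m.2.1) (frame c m.2.2)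
    rw [ea, eb, ec, form_smul_smul, form_smul_third] at this
    refine mul_right_cancel₀ hs ?_
    linear_combination this
  refine ⟨_, Subtype.fintype _, _, _, _, TwoOrthogonalFamily.restrict (x := x) (y := y) (z := z) ?_,
    (sumRankOne_restrict x y z).trans ?_⟩
  · intro m n hmn hm hn
    have := frameSign_parity (mul_ne_zero (mul_ne_zero hα hβ) hγ) ((hsgn m hm).trans (hsgn n hn).symm)
    have dz : m.2.2 ≠ n.2.2 → dot (z m) (z n) = 0 := fun hh => by
      simp only [z, dot_smul_left, dot_smul_right, dot_frame_of_ne hh, mul_zero]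
    rcases this with h0 | ⟨h0, h1⟩ | ⟨h0, h1⟩ | ⟨h0, h1⟩
    · exact absurd h0 hmn
    · exact Or.inl ⟨dot_frame_of_ne h0, dot_frame_of_ne h1⟩
    · exact Or.inr (Or.inl ⟨dot_frame_of_ne h0, dz h1⟩)
    · exact Or.inr (Or.inr ⟨dz h0, dot_frame_of_ne h1⟩)
  · funext p q r
    rw [sumRankOne_apply]
    simp only [Fintype.sum_prod_type, x, y, z, s, form_eq_dot, Pi.smul_apply, smul_eq_mul]
    rw [eq_sum_frame ha (fun p => t p q r) p]
    refine Finset.sum_congr rfl fun i _ => ?_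
    rw [eq_sum_frame hb (fun q => dot (fun p => t p q r) (frame a i)) q, Finset.sum_mul]
    refine Finset.sum_congr rfl fun j _ => ?_
    rw [eq_sum_frame hc (fun r => dot (fun q => dot (fun p => t p q r) (frame a i)) (frame b j)) r,
      Finset.sum_mul, Finset.sum_mul]
    exact Finset.sum_congr rfl fun k _ => by ring

theorem hasTwoOrthogonalFamily_of_pairDefect {t : Fin 2 → Fin 2 → Fin 2 → ℝ}
    (ht : GramRegular t) (h : pairDefect t = 0) : HasTwoOrthogonalFamily t := by
  obtain ⟨d₁, d₂, -⟩ := ht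
  obtain ⟨μ, hμ⟩ := exists_isAligned (ne_zero_of_gramDisc d₁) h
  obtain ⟨a, α, ha, hα, ea⟩ := exists_eigenframe d₁
  obtain ⟨b, β, hb, hβ, eb⟩ := exists_eigenframe d₂
  let x : Fin 2 × Fin 2 → Fin 2 → ℝ := fun m => frame a m.1
  let y : Fin 2 × Fin 2 → Fin 2 → ℝ := fun m => frame b m.2
  let z : Fin 2 × Fin 2 → Fin 2 → ℝ := fun m r =>
    dot (fun q => dot (fun p => t p q r) (frame a m.1)) (frame b m.2)
  have hsgn : ∀ m, rankOne (x m) (y m) (z m) ≠ 0 →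
      frameSign m.1 * frameSign m.2 * frameSign 0 * (α * β) = μ := by
    intro m hm
    have hz : z m ≠ 0 := fun h0 => hm (by funext p q r; simp [rankOne, h0])
    have := hμ (frame a m.1) (frame b m.2) (z m)
    rw [ea, eb, form_smul_smul, LinearMap.id_apply, form_eq_dot] at this
    refine mul_right_cancel₀ (dot_self_ne hz) ?_
    have h0 : frameSign 0 = 1 := rfl
    rw [h0]
    linear_combination this
  refine ⟨_, Subtype.fintype _, _, _, _, TwoOrthogonalFamily.restrict (x := x) (y := y) (z := z) ?_,
    (sumRankOne_restrict x y z).trans ?_⟩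
  · intro m n hmn hm hn
    have := frameSign_parity (mul_ne_zero hα hβ) ((hsgn m hm).trans (hsgn n hn).symm)
    rcases this with h0 | ⟨h0, h1⟩ | ⟨h0, h1⟩ | ⟨h0, h1⟩
    · simp only [Prod.mk.injEq, and_true] at h0
      exact absurd (Prod.ext h0.1 h0.2) hmn
    · exact Or.inl ⟨dot_frame_of_ne h0, dot_frame_of_ne h1⟩
    · exact absurd rfl h1
    · exact absurd rfl h0
  · funext p q r
    rw [sumRankOne_apply]
    simp only [Fintype.sum_prod_type, x, y, z]
    rw [eq_sum_frame ha (fun p => t p q r) p]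
    refine Finset.sum_congr rfl fun i _ => ?_
    rw [eq_sum_frame hb (fun q => dot (fun p => t p q r) (frame a i)) q, Finset.sum_mul]
    exact Finset.sum_congr rfl fun j _ => by ring

theorem GramRegular.rot {t : Fin 2 → Fin 2 → Fin 2 → ℝ} (h : GramRegular t) :
    GramRegular (rot t) := ⟨h.2.1, h.2.2, by rw [rot_rot_rot]; exact h.1⟩

theorem hasTwoOrthogonalFamily_of_totalDefect {t : Fin 2 → Fin 2 → Fin 2 → ℝ}
    (ht : GramRegular t) (h : totalDefect t = 0) : HasTwoOrthogonalFamily t := by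
  simp only [totalDefect, mul_eq_zero] at h
  rcases h with h | (h | h) | h
  · exact hasTwoOrthogonalFamily_of_evenDefect ht h
  · exact hasTwoOrthogonalFamily_of_pairDefect ht h
  · exact (hasTwoOrthogonalFamily_of_pairDefect ht.rot h).of_rot
  · exact (hasTwoOrthogonalFamily_of_pairDefect ht.rot.rot h).of_rot.of_rot

end Existence

/-! ### Lines to regular tensors -/

section Lines

/-- A sum of a nonempty family of possibly zero rank-one tensors, any two orthogonal in two
factors. -/
def IsTwoOrthogonalSum (t : Fin 2 → Fin 2 → Fin 2 → ℝ) : Prop :=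
  ∃ (r : ℕ) (_ : 1 ≤ r) (x y z : Fin r → Fin 2 → ℝ),
    (∀ i j, i ≠ j → (dot (x i) (x j) = 0 ∧ dot (y i) (y j) = 0) ∨
      (dot (y i) (y j) = 0 ∧ dot (z i) (z j) = 0) ∨
      (dot (z i) (z j) = 0 ∧ dot (x i) (x j) = 0)) ∧ sumRankOne x y z = t

theorem IsTwoOrthogonalSum.of_rot {t : Fin 2 → Fin 2 → Fin 2 → ℝ}
    (h : IsTwoOrthogonalSum (rot t)) : IsTwoOrthogonalSum t := by
  obtain ⟨r, hr, x, y, z, h, e⟩ := h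
  exact ⟨r, hr, z, x, y, fun i j hij => by have := h i j hij; tauto,
    by rw [← rot_sumRankOne, ← rot_sumRankOne, e, rot_rot_rot]⟩

/-- A line through `t` consists of two-orthogonal sums and contains a regular tensor. -/
def HasRegularLine (t : Fin 2 → Fin 2 → Fin 2 → ℝ) : Prop :=
  ∃ d, GramRegular d ∧ ∀ τ : ℝ, IsTwoOrthogonalSum (t + τ • (d - t))

theorem HasRegularLine.of_rot {t : Fin 2 → Fin 2 → Fin 2 → ℝ} (h : HasRegularLine (rot t)) :
    HasRegularLine t := by
  obtain ⟨d, hd, hl⟩ := h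
  exact ⟨rot (rot d), hd.rot.rot, fun τ => (hl τ).of_rot⟩

/-- The coefficient `2` separates the eigenvalues of the first two flattenings, whose weights become
`4` and `1`; the third Gram matrix has rank one. -/
theorem gramRegular_two_smul_add {a b c : Fin 2 → ℝ} (ha : a ≠ 0) (hb : b ≠ 0) (hc : c ≠ 0) :
    GramRegular ((2 : ℝ) • rankOne a b c + rankOne (quarterTurn a) (quarterTurn b) c) := by
  have na := dot_self_ne ha
  have nb := dot_self_ne hb
  have nc := dot_self_ne hc
  have key : ∀ {a b c : Fin 2 → ℝ} {t : Fin 2 → Fin 2 → Fin 2 → ℝ},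
      (∀ p q, gram t p q = (4 * (a p * a q) + quarterTurn a p * quarterTurn a q) *
        (dot b b * dot c c)) →
      gramDisc t = (3 * dot a a * (dot b b * dot c c)) ^ 2 := by
    intro a b c t h
    simp only [gramDisc, h]
    generalize dot b b * dot c c = N
    simp only [dot, quarterTurn_zero, quarterTurn_one]
    ring
  have key' : ∀ {a b c : Fin 2 → ℝ} {t : Fin 2 → Fin 2 → Fin 2 → ℝ},
      (∀ p q, gram t p q = 5 * (a p * a q) * (dot b b * dot c c)) →
      gramDisc t = (5 * dot a a * (dot b b * dot c c)) ^ 2 := by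
    intro a b c t h
    simp only [gramDisc, h]
    generalize dot b b * dot c c = N
    simp only [dot]
    ring
  refine ⟨?_, ?_, ?_⟩
  · rw [key (a := a) (b := b) (c := c)]
    · positivity
    · intro p q
      simp [gram, rankOne, dot, Fin.sum_univ_two]; ring
  · rw [key (a := b) (b := c) (c := a)]
    · positivity
    · intro p q
      simp [gram, rot, rankOne, dot, Fin.sum_univ_two]; ring
  · rw [key' (a := c) (b := a) (c := b)]
    · positivity
    · intro p q
      simp [gram, rot, rankOne, dot, Fin.sum_univ_two]; ring

/-- The even tensors of the orthogonal frame given by `a`, `b`, `c`. -/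
def evenFrame (a b c : Fin 2 → ℝ) : Fin 4 → Fin 2 → Fin 2 → Fin 2 → ℝ :=
  ![rankOne a b c, rankOne a (quarterTurn b) (quarterTurn c),
    rankOne (quarterTurn a) b (quarterTurn c), rankOne (quarterTurn a) (quarterTurn b) c]

theorem isTwoOrthogonalSum_of_mem_span {a b c : Fin 2 → ℝ} {t : Fin 2 → Fin 2 → Fin 2 → ℝ}
    (ht : t ∈ Submodule.span ℝ (Set.range (evenFrame a b c))) : IsTwoOrthogonalSum t := by
  obtain ⟨s, rfl⟩ := (Submodule.mem_span_range_iff_exists_fun ℝ).mp ht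
  refine ⟨4, by norm_num, ![s 0 • a, s 1 • a, s 2 • quarterTurn a, s 3 • quarterTurn a],
    ![b, quarterTurn b, b, quarterTurn b], ![c, quarterTurn c, quarterTurn c, c], ?_, ?_⟩
  · intro i j hij
    fin_cases i <;> fin_cases j <;>
      simp [dot_smul_left, dot_smul_right, dot_quarterTurn_self,
        dot_comm (quarterTurn _) _] at hij ⊢
  · funext p q r
    simp [sumRankOne, Fin.sum_univ_four, evenFrame, rankOne]
    ring

variable {ι : Type*} [Fintype ι] {x y z : ι → Fin 2 → ℝ}

theorem TwoOrthogonalFamily.hasRegularLine_of_even (h : TwoOrthogonalFamily x y z)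
    (he : EvenFamily x y z) : HasRegularLine (sumRankOne x y z) := by
  obtain ⟨a, b, c, ha, hb, hc, hm⟩ : ∃ a b c : Fin 2 → ℝ, a ≠ 0 ∧ b ≠ 0 ∧ c ≠ 0 ∧
      sumRankOne x y z ∈ Submodule.span ℝ (Set.range (evenFrame a b c)) := by
    rcases isEmpty_or_nonempty ι with hι | ⟨⟨o⟩⟩
    -- The empty sum is zero, and any frame will do.
    · have : (![1, 0] : Fin 2 → ℝ) ≠ 0 := fun h0 => by simpa using congrFun h0 0
      exact ⟨_, _, _, this, this, this, by simp [sumRankOne]⟩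
    · refine ⟨x o, y o, z o, h.1 o, h.2 o, h.3 o, Submodule.sum_mem _ fun i _ => ?_⟩
      have gen : ∀ k (s : ℝ), s • evenFrame (x o) (y o) (z o) k ∈
          Submodule.span ℝ (Set.range (evenFrame (x o) (y o) (z o))) := fun k s =>
        Submodule.smul_mem _ _ (Submodule.subset_span ⟨k, rfl⟩)
      by_cases hi : o = i
      · subst hi
        simpa [evenFrame] using gen 0 1
      rcases he o i hi with ⟨e₁, e₂, e₃⟩ | ⟨e₁, e₂, e₃⟩ | ⟨e₁, e₂, e₃⟩
      · obtain ⟨p, hp⟩ := exists_smul_of_area (h.1 o) e₁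
        obtain ⟨q, hq⟩ := exists_smul_of_dot (h.2 o) e₂
        obtain ⟨r, hr⟩ := exists_smul_of_dot (h.3 o) e₃
        convert gen 1 (p * q * r) using 1
        funext u v w
        simp [evenFrame, rankOne, hp, hq, hr]; ring
      · obtain ⟨p, hp⟩ := exists_smul_of_dot (h.1 o) e₁
        obtain ⟨q, hq⟩ := exists_smul_of_area (h.2 o) e₂
        obtain ⟨r, hr⟩ := exists_smul_of_dot (h.3 o) e₃
        convert gen 2 (p * q * r) using 1
        funext u v w
        simp [evenFrame, rankOne, hp, hq, hr]; ring
      · obtain ⟨p, hp⟩ := exists_smul_of_dot (h.1 o) e₁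
        obtain ⟨q, hq⟩ := exists_smul_of_dot (h.2 o) e₂
        obtain ⟨r, hr⟩ := exists_smul_of_area (h.3 o) e₃
        convert gen 3 (p * q * r) using 1
        funext u v w
        simp [evenFrame, rankOne, hp, hq, hr]; ring
  refine ⟨_, gramRegular_two_smul_add ha hb hc, fun τ => ?_⟩
  refine isTwoOrthogonalSum_of_mem_span (a := a) (b := b) (c := c) ?_
  refine Submodule.add_mem _ hm (Submodule.smul_mem _ _ (Submodule.sub_mem _ ?_ hm))
  exact Submodule.add_mem _ (Submodule.smul_mem _ _ (Submodule.subset_span ⟨0, rfl⟩))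
    (Submodule.subset_span ⟨3, rfl⟩)

theorem TwoOrthogonalFamily.hasRegularLine_of_pair (h : TwoOrthogonalFamily x y z)
    (hp : PairFamily x y) : HasRegularLine (sumRankOne x y z) := by
  obtain ⟨i, j, hij, hl, hx, hy⟩ := hp
  obtain ⟨p, hp⟩ := exists_smul_of_dot (h.1 i) hx
  obtain ⟨q, hq⟩ := exists_smul_of_dot (h.2 i) hy
  refine ⟨_, gramRegular_two_smul_add (h.1 i) (h.2 i) (h.3 i), fun τ => ?_⟩
  -- The first two factors stay fixed along the line. Only the third factors move, and they are
  -- unconstrained; the scalars `p`, `q` are absorbed there.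
  refine ⟨2, by norm_num, ![x i, quarterTurn (x i)], ![y i, quarterTurn (y i)],
    ![z i + τ • (2 • z i - z i), (p * q) • z j + τ • (z i - (p * q) • z j)], ?_, ?_⟩
  · intro k l hkl
    fin_cases k <;> fin_cases l <;>
      simp [dot_quarterTurn_self, dot_comm (quarterTurn _) _] at hkl ⊢
  · have hs : sumRankOne x y z = rankOne (x i) (y i) (z i) + rankOne (x j) (y j) (z j) := by
      classical
      rw [sumRankOne, ← Finset.sum_pair hij (f := fun l => rankOne (x l) (y l) (z l))]
      exact (Finset.sum_subset (Finset.subset_univ _) fun l _ hn => absurd (by simpa using hl l) hn).symm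
    rw [hs]
    funext u v w
    simp [sumRankOne, Fin.sum_univ_two, rankOne, hp, hq]
    ring

theorem TwoOrthogonalFamily.hasRegularLine (h : TwoOrthogonalFamily x y z) :
    HasRegularLine (sumRankOne x y z) := by
  rcases h.classification with he | he | he | he
  · exact h.hasRegularLine_of_even he
  · exact h.hasRegularLine_of_pair he
  · refine HasRegularLine.of_rot ?_
    rw [rot_sumRankOne]
    exact h.rot.hasRegularLine_of_pair he
  · refine HasRegularLine.of_rot (HasRegularLine.of_rot ?_)
    rw [rot_sumRankOne, rot_sumRankOne]
    exact h.rot.rot.hasRegularLine_of_pair he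

theorem IsTwoOrthogonalSum.exists_family {t : Fin 2 → Fin 2 → Fin 2 → ℝ}
    (h : IsTwoOrthogonalSum t) : HasTwoOrthogonalFamily t := by
  classical
  obtain ⟨r, -, x, y, z, h, rfl⟩ := h
  exact ⟨_, Subtype.fintype _, _, _, _, TwoOrthogonalFamily.restrict fun i j hij _ _ => h i j hij,
    sumRankOne_restrict x y z⟩

end Lines

/-! ### Polynomial functions and closures along lines -/

section ZariskiClosure

variable {V : Type*} [AddCommGroup V] [Module ℝ V]

/-- `f` is a polynomial function. -/
def IsPolyFun (f : V → ℝ) : Prop :=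
  ∃ p : MvPolynomial (Module.Dual ℝ V) ℝ, ∀ v, polyEval p v = f v

theorem IsPolyFun.const (c : ℝ) : IsPolyFun fun _ : V => c :=
  ⟨MvPolynomial.C c, fun v => by simp [polyEval]⟩

theorem IsPolyFun.linear (φ : V →ₗ[ℝ] ℝ) : IsPolyFun fun v => φ v :=
  ⟨MvPolynomial.X φ, fun v => by simp [polyEval]⟩

theorem IsPolyFun.add {f g : V → ℝ} (hf : IsPolyFun f) (hg : IsPolyFun g) :
    IsPolyFun fun v => f v + g v := by
  obtain ⟨p, hp⟩ := hf
  obtain ⟨q, hq⟩ := hg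
  exact ⟨p + q, fun v => by simp only [← hp, ← hq]; simp [polyEval]⟩

theorem IsPolyFun.mul {f g : V → ℝ} (hf : IsPolyFun f) (hg : IsPolyFun g) :
    IsPolyFun fun v => f v * g v := by
  obtain ⟨p, hp⟩ := hf
  obtain ⟨q, hq⟩ := hg
  exact ⟨p * q, fun v => by simp only [← hp, ← hq]; simp [polyEval]⟩

theorem IsPolyFun.sub {f g : V → ℝ} (hf : IsPolyFun f) (hg : IsPolyFun g) :
    IsPolyFun fun v => f v - g v := by
  obtain ⟨p, hp⟩ := hf
  obtain ⟨q, hq⟩ := hg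
  exact ⟨p - q, fun v => by simp only [← hp, ← hq]; simp [polyEval]⟩

theorem IsPolyFun.sq {f : V → ℝ} (hf : IsPolyFun f) : IsPolyFun fun v => f v ^ 2 := by
  simp only [pow_two]
  exact hf.mul hf

theorem IsPolyFun.sum {κ : Type*} (s : Finset κ) {f : κ → V → ℝ} (hf : ∀ i, IsPolyFun (f i)) :
    IsPolyFun fun v => ∑ i ∈ s, f i v := by
  choose p hp using hf
  refine ⟨∑ i ∈ s, p i, fun v => ?_⟩
  simp only [← hp, polyEval, map_sum]

theorem mem_zariskiClosure {S : Set V} {v : V} : v ∈ zariskiClosure S ↔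
    ∀ p : MvPolynomial (Module.Dual ℝ V) ℝ, (∀ s ∈ S, polyEval p s = 0) → polyEval p v = 0 := by
  constructor
  · intro h p hp
    exact h {v | ∀ q ∈ ({p} : Set _), polyEval q v = 0} ⟨⟨_, rfl⟩, fun s hs q hq => by rw [hq, hp s hs]⟩ p rfl
  · rintro h _ ⟨⟨I, rfl⟩, hS⟩ p hp
    exact h p fun s hs => hS hs p hp

theorem subset_zariskiClosure (S : Set V) : S ⊆ zariskiClosure S := fun _ hv _ hZ => hZ.2 hv

theorem IsPolyFun.isZariskiOpen {f : V → ℝ} (hf : IsPolyFun f) : IsZariskiOpen {v | f v ≠ 0} := by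
  obtain ⟨p, hp⟩ := hf
  exact ⟨{p}, by ext v; simp [hp]⟩

/-- The restriction of a polynomial function to a line. -/
theorem exists_polynomial_line (p : MvPolynomial (Module.Dual ℝ V) ℝ) (v w : V) :
    ∃ q : Polynomial ℝ, ∀ τ, q.eval τ = polyEval p (v + τ • w) := by
  induction p using MvPolynomial.induction_on with
  | C c => exact ⟨Polynomial.C c, fun τ => by simp [polyEval]⟩
  | add p q hp hq =>
    obtain ⟨P, hP⟩ := hp
    obtain ⟨Q, hQ⟩ := hq
    exact ⟨P + Q, fun τ => by rw [Polynomial.eval_add, hP, hQ]; simp [polyEval]⟩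
  | mul_X p φ hp =>
    obtain ⟨P, hP⟩ := hp
    exact ⟨P * (Polynomial.C (φ v) + Polynomial.X * Polynomial.C (φ w)),
      fun τ => by rw [Polynomial.eval_mul, hP]; simp [polyEval, mul_comm τ]⟩

/-- A point lies in the closure of the part of a line through it where a polynomial function does
not vanish. -/
theorem mem_zariskiClosure_of_line {f : V → ℝ} (hf : IsPolyFun f) {S : Set V} {v w : V}
    (hw : f w ≠ 0) (hS : ∀ τ : ℝ, f (v + τ • (w - v)) ≠ 0 → v + τ • (w - v) ∈ S) :
    v ∈ zariskiClosure S := by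
  obtain ⟨p, hp⟩ := hf
  rw [mem_zariskiClosure]
  intro g hg
  obtain ⟨P, hP⟩ := exists_polynomial_line p v (w - v)
  obtain ⟨G, hG⟩ := exists_polynomial_line g v (w - v)
  -- The product vanishes at every real parameter. Since `P` is nonzero at `1`, where the line
  -- reaches `w`, `G` is zero, in particular at `0`.
  have h0 : P * G = 0 := by
    refine Polynomial.funext fun τ => ?_
    rw [Polynomial.eval_mul, hP, hG, hp, Polynomial.eval_zero]
    by_cases h : f (v + τ • (w - v)) = 0
    · rw [h, zero_mul]
    · rw [hg _ (hS τ h), mul_zero]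
  have hP0 : P ≠ 0 := by
    rintro rfl
    have := hP 1
    rw [hp] at this
    simp only [Polynomial.eval_zero, one_smul, add_sub_cancel] at this
    exact hw this.symm
  have := hG 0
  rw [(mul_eq_zero.mp h0).resolve_left hP0] at this
  simpa using this.symm

end ZariskiClosure

/-! ### Polynomiality of the discriminants and defects -/

section PolynomialCoordinates

variable {V : Type*} [AddCommGroup V] [Module ℝ V] {T : V → Fin 2 → Fin 2 → Fin 2 → ℝ}

theorem IsPolyFun.form (hT : ∀ i j k, IsPolyFun fun v => T v i j k) {a b c : V → Fin 2 → ℝ}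
    (ha : ∀ i, IsPolyFun fun v => a v i) (hb : ∀ i, IsPolyFun fun v => b v i)
    (hc : ∀ i, IsPolyFun fun v => c v i) : IsPolyFun fun v => form (T v) (a v) (b v) (c v) :=
  IsPolyFun.sum _ fun i => IsPolyFun.sum _ fun j => IsPolyFun.sum _ fun k =>
    (((hT i j k).mul (ha i)).mul (hb j)).mul (hc k)

theorem IsPolyFun.gram (hT : ∀ i j k, IsPolyFun fun v => T v i j k) (p q : Fin 2) :
    IsPolyFun fun v => gram (T v) p q :=
  IsPolyFun.sum _ fun j => IsPolyFun.sum _ fun k => (hT p j k).mul (hT q j k)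

theorem IsPolyFun.gramDisc (hT : ∀ i j k, IsPolyFun fun v => T v i j k) :
    IsPolyFun fun v => gramDisc (T v) :=
  ((gram hT 0 0).sub (gram hT 1 1)).sq.add ((IsPolyFun.const 2).mul (gram hT 0 1)).sq

theorem IsPolyFun.scaledReflection (hT : ∀ i j k, IsPolyFun fun v => T v i j k)
    (u : Fin 2 → ℝ) (i : Fin 2) : IsPolyFun fun v => scaledReflection (T v) u i := by
  have hA := (gram hT 0 0).sub (gram hT 1 1)
  have hB := (IsPolyFun.const 2).mul (gram hT 0 1)
  fin_cases i
  · simp only [Fin.zero_eta, scaledReflection_zero]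
    exact (hA.mul (const _)).add (hB.mul (const _))
  · simp only [Fin.mk_one, scaledReflection_one]
    exact (hB.mul (const _)).sub (hA.mul (const _))

theorem IsPolyFun.alignDefect (hT : ∀ i j k, IsPolyFun fun v => T v i j k)
    {A B C : V → (Fin 2 → ℝ) →ₗ[ℝ] (Fin 2 → ℝ)} (hA : ∀ u i, IsPolyFun fun v => A v u i)
    (hB : ∀ u i, IsPolyFun fun v => B v u i) (hC : ∀ u i, IsPolyFun fun v => C v u i) :
    IsPolyFun fun v => alignDefect (T v) (A v) (B v) (C v) :=
  IsPolyFun.sum _ fun _ => (((form hT (hA _) (hB _) (hC _)).mul (hT _ _ _)).sub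
    ((form hT (hA _) (hB _) (hC _)).mul (hT _ _ _))).sq

theorem IsPolyFun.evenDefect (hT : ∀ i j k, IsPolyFun fun v => T v i j k) :
    IsPolyFun fun v => evenDefect (T v) :=
  alignDefect hT (scaledReflection hT)
    (scaledReflection (T := fun v => rot (T v)) fun i j k => hT k i j)
    (scaledReflection (T := fun v => rot (rot (T v))) fun i j k => hT j k i)

theorem IsPolyFun.pairDefect (hT : ∀ i j k, IsPolyFun fun v => T v i j k) :
    IsPolyFun fun v => pairDefect (T v) :=
  alignDefect hT (scaledReflection hT)
    (scaledReflection (T := fun v => rot (T v)) fun i j k => hT k i j)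
    (fun _ _ => const _)

theorem IsPolyFun.totalDefect (hT : ∀ i j k, IsPolyFun fun v => T v i j k) :
    IsPolyFun fun v => totalDefect (T v) :=
  (evenDefect hT).mul (((pairDefect hT).mul
    (pairDefect (T := fun v => rot (T v)) fun i j k => hT k i j)).mul
    (pairDefect (T := fun v => rot (rot (T v))) fun i j k => hT j k i))

end PolynomialCoordinates

/-! ### The tensor product in coordinates -/

section Coordinates

/-- The coordinates of a tensor in the standard basis. -/
noncomputable def coords : (⨂[ℝ] _ : Fin 3, EuclideanSpace ℝ (Fin 2)) →ₗ[ℝ]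
    (Fin 2 → Fin 2 → Fin 2 → ℝ) :=
  LinearMap.pi fun i => LinearMap.pi fun j => LinearMap.pi fun k =>
    (Basis.piTensorProduct fun _ : Fin 3 =>
      (EuclideanSpace.basisFun (Fin 2) ℝ).toBasis).coord ![i, j, k]

theorem coords_tprod (x : Fin 3 → EuclideanSpace ℝ (Fin 2)) :
    coords (⨂ₜ[ℝ] k, x k) = rankOne (x 0) (x 1) (x 2) := by
  funext i j k
  simp [coords, rankOne, Fin.prod_univ_three]

theorem coords_injective : Function.Injective coords := by
  intro s t h
  refine (Basis.piTensorProduct fun _ : Fin 3 =>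
      (EuclideanSpace.basisFun (Fin 2) ℝ).toBasis).ext_elem fun p => ?_
  have := congrFun (congrFun (congrFun h (p 0)) (p 1)) (p 2)
  have e : ![p 0, p 1, p 2] = p := by ext i; fin_cases i <;> rfl
  simpa [coords, e] using this

theorem coords_sum {r : ℕ} (x : Fin r → Fin 3 → EuclideanSpace ℝ (Fin 2)) :
    coords (∑ i, ⨂ₜ[ℝ] k, x i k) =
      sumRankOne (fun i => x i 0) (fun i => x i 1) (fun i => x i 2) := by
  simp only [map_sum, coords_tprod, sumRankOne]

theorem inner_eq_dot (x y : EuclideanSpace ℝ (Fin 2)) : inner ℝ x y = dot x y := by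
  simp [PiLp.inner_apply, Fin.sum_univ_two, dot]; ring

theorem areTwoOrthogonal_iff (x y : Fin 3 → EuclideanSpace ℝ (Fin 2)) :
    AreTwoOrthogonal x y ↔ (dot (x 0) (y 0) = 0 ∧ dot (x 1) (y 1) = 0) ∨
      (dot (x 1) (y 1) = 0 ∧ dot (x 2) (y 2) = 0) ∨
      (dot (x 2) (y 2) = 0 ∧ dot (x 0) (y 0) = 0) := by
  simp only [AreTwoOrthogonal, inner_eq_dot]
  constructor
  · rintro ⟨i, j, hij, h, h'⟩
    fin_cases i <;> fin_cases j <;> simp at hij h h' <;> tauto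
  · rintro (⟨h, h'⟩ | ⟨h, h'⟩ | ⟨h, h'⟩)
    · exact ⟨0, 1, by decide, h, h'⟩
    · exact ⟨1, 2, by decide, h, h'⟩
    · exact ⟨2, 0, by decide, h, h'⟩

/-- The triples of Euclidean vectors with the given coordinates. -/
def euclideanTriple {r : ℕ} (x y z : Fin r → Fin 2 → ℝ) (i : Fin r) :
    Fin 3 → EuclideanSpace ℝ (Fin 2) :=
  ![WithLp.toLp 2 (x i), WithLp.toLp 2 (y i), WithLp.toLp 2 (z i)]

theorem isTwoOrthogonalDecomposition_iff {T : ⨂[ℝ] _ : Fin 3, EuclideanSpace ℝ (Fin 2)} {r : ℕ}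
    (x : Fin r → Fin 3 → EuclideanSpace ℝ (Fin 2)) :
    IsTwoOrthogonalDecomposition T x ↔
      TwoOrthogonalFamily (fun i => x i 0) (fun i => x i 1) (fun i => x i 2) ∧
        sumRankOne (fun i => ⇑(x i 0)) (fun i => x i 1) (fun i => x i 2) = coords T := by
  constructor
  · rintro ⟨h₁, h₂, h₃⟩
    have hne : ∀ i, rankOne (x i 0) (x i 1) (x i 2) ≠ 0 := fun i h0 => h₂ i <| by
      apply coords_injective
      rw [coords_tprod, h0, map_zero]
    refine ⟨⟨fun i h0 => hne i ?_, fun i h0 => hne i ?_, fun i h0 => hne i ?_,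
      fun i j hij => (areTwoOrthogonal_iff _ _).mp (h₃ i j hij)⟩, by rw [h₁, coords_sum]⟩ <;>
    · funext p q s
      simp [rankOne, h0]
  · rintro ⟨h, hs⟩
    refine ⟨coords_injective (by rw [coords_sum, hs]), fun i h0 => ?_,
      fun i j hij => (areTwoOrthogonal_iff _ _).mpr (h.4 i j hij)⟩
    have h1 := coords_tprod (x i)
    rw [h0, map_zero] at h1
    exact h.rankOne_ne_zero i h1.symm

theorem TwoOrthogonalFamily.reindex {ι κ : Type*} [Fintype ι] [Fintype κ] {x y z : ι → Fin 2 → ℝ}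
    (h : TwoOrthogonalFamily x y z) (σ : κ ≃ ι) :
    TwoOrthogonalFamily (fun i => x (σ i)) (fun i => y (σ i)) (fun i => z (σ i)) ∧
      sumRankOne (fun i => x (σ i)) (fun i => y (σ i)) (fun i => z (σ i)) = sumRankOne x y z :=
  ⟨⟨fun _ => h.1 _, fun _ => h.2 _, fun _ => h.3 _, fun _ _ hij => h.4 _ _ (σ.injective.ne hij)⟩,
    Equiv.sum_comp σ fun i => rankOne (x i) (y i) (z i)⟩

theorem exists_isTwoOrthogonalDecomposition {T : ⨂[ℝ] _ : Fin 3, EuclideanSpace ℝ (Fin 2)}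
    (h : HasTwoOrthogonalFamily (coords T)) :
    ∃ (r : ℕ) (x : Fin r → Fin 3 → EuclideanSpace ℝ (Fin 2)),
      IsTwoOrthogonalDecomposition T x := by
  obtain ⟨ι, _, x, y, z, h, hs⟩ := h
  obtain ⟨h', hs'⟩ := h.reindex (Fintype.equivFin ι).symm
  exact ⟨_, euclideanTriple _ _ _,
    (isTwoOrthogonalDecomposition_iff _).mpr ⟨h', hs'.trans hs⟩⟩

theorem hasUniqueTwoOrthogonalDecomposition_of_gramRegular
    {T : ⨂[ℝ] _ : Fin 3, EuclideanSpace ℝ (Fin 2)} (hT : GramRegular (coords T))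
    (h : HasTwoOrthogonalFamily (coords T)) : HasUniqueTwoOrthogonalDecomposition T := by
  obtain ⟨r, x, hx⟩ := exists_isTwoOrthogonalDecomposition h
  refine ⟨r, x, hx, fun s y hy => ?_⟩
  obtain ⟨fx, sx⟩ := (isTwoOrthogonalDecomposition_iff x).mp hx
  obtain ⟨fy, sy⟩ := (isTwoOrthogonalDecomposition_iff y).mp hy
  obtain ⟨σ, hσ⟩ := fx.exists_equiv fy (sx.trans sy.symm) (sx ▸ hT)
  exact ⟨σ, fun j => coords_injective (by rw [coords_tprod, coords_tprod, hσ j])⟩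

theorem isTwoOrthogonalSum_coords {r : ℕ} (hr : 1 ≤ r)
    {x : Fin r → Fin 3 → EuclideanSpace ℝ (Fin 2)}
    (hx : ∀ i j, i ≠ j → AreTwoOrthogonal (x i) (x j)) :
    IsTwoOrthogonalSum (coords (∑ i, ⨂ₜ[ℝ] k, x i k)) :=
  ⟨r, hr, _, _, _, fun i j hij => (areTwoOrthogonal_iff _ _).mp (hx i j hij), (coords_sum x).symm⟩

theorem IsTwoOrthogonalSum.exists_mem_variety {t : Fin 2 → Fin 2 → Fin 2 → ℝ}
    (h : IsTwoOrthogonalSum t) :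
    ∃ T ∈ twoOrthogonalVariety (fun _ : Fin 3 => EuclideanSpace ℝ (Fin 2)), coords T = t := by
  obtain ⟨r, hr, x, y, z, h, hs⟩ := h
  refine ⟨∑ i, ⨂ₜ[ℝ] k, euclideanTriple x y z i k, ?_, (coords_sum _).trans hs⟩
  refine subset_zariskiClosure _ (Set.mem_iUnion₂.mpr ⟨r, hr, subset_zariskiClosure _ ?_⟩)
  exact ⟨_, fun i j hij => (areTwoOrthogonal_iff _ _).mpr (h i j hij), rfl⟩

/-- A polynomial function that vanishes on all two-orthogonal sums vanishes on the variety. -/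
theorem polyEval_eq_zero_of_mem_variety
    {p : MvPolynomial (Module.Dual ℝ (⨂[ℝ] _ : Fin 3, EuclideanSpace ℝ (Fin 2))) ℝ}
    (hp : ∀ T, IsTwoOrthogonalSum (coords T) → polyEval p T = 0)
    {T : ⨂[ℝ] _ : Fin 3, EuclideanSpace ℝ (Fin 2)}
    (hT : T ∈ twoOrthogonalVariety (fun _ : Fin 3 => EuclideanSpace ℝ (Fin 2))) :
    polyEval p T = 0 := by
  refine mem_zariskiClosure.mp hT p fun S hS => ?_
  obtain ⟨r, hr, hS⟩ := Set.mem_iUnion₂.mp hS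
  refine mem_zariskiClosure.mp hS p ?_
  rintro _ ⟨x, hx, rfl⟩
  exact hp _ (isTwoOrthogonalSum_coords hr hx)

theorem isPolyFun_coords (i j k : Fin 2) :
    IsPolyFun fun T : ⨂[ℝ] _ : Fin 3, EuclideanSpace ℝ (Fin 2) => coords T i j k :=
  IsPolyFun.linear ((LinearMap.proj k).comp ((LinearMap.proj j).comp
    ((LinearMap.proj i).comp coords)))

theorem totalDefect_coords_eq_zero {T : ⨂[ℝ] _ : Fin 3, EuclideanSpace ℝ (Fin 2)}
    (hT : T ∈ twoOrthogonalVariety (fun _ : Fin 3 => EuclideanSpace ℝ (Fin 2))) :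
    totalDefect (coords T) = 0 := by
  obtain ⟨p, hp⟩ := IsPolyFun.totalDefect isPolyFun_coords
  refine (hp T).symm.trans ?_
  refine polyEval_eq_zero_of_mem_variety (fun S hS => ?_) hT
  obtain ⟨ι, _, x, y, z, h, hs⟩ := hS.exists_family
  exact (hp S).trans ((congrArg totalDefect hs).symm.trans h.totalDefect_eq_zero)

theorem exists_isPolyFun_gramRegular :
    ∃ f : (⨂[ℝ] _ : Fin 3, EuclideanSpace ℝ (Fin 2)) → ℝ, IsPolyFun f ∧
      ∀ T, f T ≠ 0 ↔ GramRegular (coords T) :=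
  ⟨_, (IsPolyFun.gramDisc isPolyFun_coords).mul
    ((IsPolyFun.gramDisc (T := fun T => rot (coords T)) fun i j k => isPolyFun_coords k i j).mul
    (IsPolyFun.gramDisc (T := fun T => rot (rot (coords T))) fun i j k => isPolyFun_coords j k i)),
    fun T => by simp only [mul_ne_zero_iff, GramRegular]⟩

end Coordinates

/-- A generic tensor of the two-orthogonal variety in `ℝ² ⊗ ℝ² ⊗ ℝ²` (with the Euclidean inner
product on each factor) has a unique two-orthogonal decomposition. -/
theorem theorem1p4 :
    HoldsGenerically
      (twoOrthogonalVariety (fun _ : Fin 3 => EuclideanSpace ℝ (Fin 2)))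
      (fun T => HasUniqueTwoOrthogonalDecomposition T) := by
  obtain ⟨f, hf, hreg⟩ := exists_isPolyFun_gramRegular
  refine ⟨{T | f T ≠ 0}, hf.isZariskiOpen, fun T hT => ?_, fun T hT => ?_⟩
  -- Vanishing on the variety need only be checked on actual two-orthogonal sums.
  · refine mem_zariskiClosure.mpr fun p hp => polyEval_eq_zero_of_mem_variety (fun S hS => ?_) hT
    obtain ⟨ι, _, x, y, z, h, hs⟩ := hS.exists_family
    obtain ⟨d, hd, hl⟩ := h.hasRegularLine
    rw [hs] at hl
    -- The regular tensor is the point of the line at parameter `1`.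
    obtain ⟨D, -, rfl⟩ : ∃ D ∈ twoOrthogonalVariety (fun _ : Fin 3 => EuclideanSpace ℝ (Fin 2)),
        coords D = d := by simpa using (hl 1).exists_mem_variety
    refine mem_zariskiClosure.mp (mem_zariskiClosure_of_line hf ((hreg D).mpr hd) ?_) p hp
    refine fun τ hτ => ⟨?_, hτ⟩
    obtain ⟨R, hR, e⟩ := (hl τ).exists_mem_variety
    rw [← map_sub, ← map_smul, ← map_add] at e
    exact coords_injective e ▸ hR
  · exact hasUniqueTwoOrthogonalDecomposition_of_gramRegular ((hreg T).mp hT.2)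
      (hasTwoOrthogonalFamily_of_totalDefect ((hreg T).mp hT.2) (totalDefect_coords_eq_zero hT.1))
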